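/- **Pointwise product of $N=2$ irreducible $\mathrm{SU}(2)$ quasicharacters.** For a spin $j\in\{0,\tfrac12,1,\dots\}$ let $(H_j,D_j)$ be the standard unitary irreducible representation of $\mathrm{SU}(2)$ of spin $j$, let $[j]=2j+1$, and let $\langle j_1,j_2\rangle=\{|j_1-j_2|,|j_1-j_2|+1,\dots,j_1+j_2\}$. For $k\in\langle j_1,j_2\rangle$ let $\mathbb P^k_{j_1j_2}$ be the orthogonal projector of $H_{j_1}\otimes H_{j_2}$ onto its spin-$k$ subspace under $u\mapsto D_{j_1}(u)\otimes D_{j_2}(u)$, and let $$\chi^k_{j_1j_2}(u,v)=\operatorname{Tr}\big(\mathbb P^k_{j_1j_2}\,(D_{j_1}(u)\otimes D_{j_2}(v))\big),\qquad u,v\in \mathrm{SU}(2).$$ Fix spins $j_1,j_2,j_1',j_2'$ and $k\in\langle j_1,j_2\rangle$, $k'\in\langle j_1',j_2'\rangle$. Let $\mathrm{SU}(2)\times\mathrm{SU}(2)$ act on $H=H_{j_1}\otimes H_{j_2}\otimes H_{j_1'}\otimes H_{j_2'}$ by $D(u,v)=D_{j_1}(u)\otimes D_{j_2}(v)\otimes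 D_{j_1'}(u)\otimes D_{j_2'}(v)$. For $J_1\in\langle j_1,j_1'\rangle$ and $J_2\in\langle j_2,j_2'\rangle$ let $\Pi_{J_1J_2}$ be the orthogonal projector of $H$ onto the copy of $H_{J_1}\otimes H_{J_2}$ in $H$, and for $K\in\langle J_1,J_2\rangle$ let $\widehat{\mathbb P}^K_{J_1J_2}$ (the grand projector) be the orthogonal projector of $H$ onto the spin-$K$ subspace of that copy. Put $$c^{K}_{J_1J_2}=[J_1][J_2][k][k']\begin{Bmatrix} j_1&j_2&k\\ j_1'&j_2'&k'\\ J_1&J_2&K\end{Bmatrix}^2$$ with the Wigner $9j$ symbol. All sums below run over $J_1\in\langle j_1,j_1'\rangle$, $J_2\in\langle j_2,j_2'\rangle$, $K\in\langle J_1,J_2\rangle$. Then: 1. the part of $\mathbb P^k_{j_1j_2}\otimes\mathbb P^{k'}_{j_1'j_2'}$ that is block diagonal with respect to $H=\bigoplus_{J_1,J_2}\Pi_{J_1J_2}H$ is $$\sum_{J_1,J_2}\Pi_{J_1J_2}\,\big(\mathbb P^k_{j_1j_2}\otimes\mathbb P^{k'}_{j_1'j_2'}\big)\,\Pi_{J_1J_2}=\sum_{J_1,J_2,K}c^K_{J_1J_2}\,\widehat{\mathbb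 P}^K_{J_1J_2};$$ 2. for all $u,v\in\mathrm{SU}(2)$, $$\operatorname{Tr}\big((\mathbb P^k_{j_1j_2}\otimes\mathbb P^{k'}_{j_1'j_2'})\,D(u,v)\big)=\sum_{J_1,J_2,K}c^K_{J_1J_2}\operatorname{Tr}\big(\widehat{\mathbb P}^K_{J_1J_2}\,D(u,v)\big);$$ 3. for all $u,v\in\mathrm{SU}(2)$, $$\chi^k_{j_1j_2}(u,v)\,\chi^{k'}_{j_1'j_2'}(u,v)=\sum_{J_1,J_2,K}c^K_{J_1J_2}\,\chi^K_{J_1J_2}(u,v).$$ -/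

import Mathlib

open scoped TensorProduct Nat
open Polynomial (C X)

noncomputable section

namespace SpinRecoupling

/-! Throughout, a spin `j ∈ {0, 1/2, 1, ...}` is encoded by its Dynkin label `n = 2j : ℕ`, so that
`[j] = 2j + 1 = n + 1`.  The ladder vector `|j, m⟩` is encoded by the index
`p = j + m ∈ {0, ..., n}`, so that `j - m = n - p`. -/

/-- The group `SU(2)`. -/
abbrev SU2 : Type := Matrix.specialUnitaryGroup (Fin 2) ℂ

/-- The Hilbert space of the spin-`n/2` representation, with its orthonormal ladder basis. -/
abbrev SpinSpace (n : ℕ) : Type := EuclideanSpace ℂ (Fin (n + 1))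

/-- `(u₀₀ x + u₁₀)^q (u₀₁ x + u₁₁)^(n-q)`: the image of the monomial `x^q y^(n-q)` under the linear
substitution `u` of `x, y`, dehomogenised at `y = 1`. -/
def binaryForm (n : ℕ) (u : Matrix (Fin 2) (Fin 2) ℂ) (q : ℕ) : Polynomial ℂ :=
  (C (u 0 0) * X + C (u 1 0)) ^ q * (C (u 0 1) * X + C (u 1 1)) ^ (n - q)

/-- The squared norm `p! (n-p)!` of the monomial `x^p y^(n-p)`. -/
def formWeight (n p : ℕ) : ℝ := (p ! : ℝ) * ((n - p)! : ℝ)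

/-- The matrix of `u` on binary forms of degree `n`, in the orthonormal basis
`x^p y^(n-p) / √(p! (n-p)!)` (the Wigner matrix of spin `n/2`). -/
def spinMatrix (n : ℕ) (u : Matrix (Fin 2) (Fin 2) ℂ) :
    Matrix (Fin (n + 1)) (Fin (n + 1)) ℂ :=
  Matrix.of fun p q =>
    ((√(formWeight n p) / √(formWeight n q) : ℝ) : ℂ) * (binaryForm n u q).coeff p

theorem sqrt_formWeight_ne_zero (n p : ℕ) : √(formWeight n p) ≠ 0 := by
  unfold formWeight; positivity

theorem spinMatrix_one (n : ℕ) : spinMatrix n 1 = 1 := by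
  ext p q
  have h : binaryForm n 1 q = X ^ (q : ℕ) := by simp [binaryForm]
  by_cases hpq : p = q
  · subst hpq
    simp [spinMatrix, h, sqrt_formWeight_ne_zero n p]
  · have : (p : ℕ) ≠ q := fun e => hpq (Fin.ext e)
    simp [spinMatrix, h, Polynomial.coeff_X_pow, hpq, this]

theorem sum_binaryForm_mul (n : ℕ) (u : Matrix (Fin 2) (Fin 2) ℂ) (a b : ℂ) (f : Polynomial ℂ)
    (hf : f.natDegree ≤ n) :
    ∑ q ∈ Finset.range (n + 2), C (((C a * X + C b) * f).coeff q) * binaryForm (n + 1) u q =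
      (C a * (C (u 0 0) * X + C (u 1 0)) + C b * (C (u 0 1) * X + C (u 1 1))) *
        ∑ q ∈ Finset.range (n + 1), C (f.coeff q) * binaryForm n u q := by
  have h1 : ∑ q ∈ Finset.range (n + 2), C ((C b * f).coeff q) * binaryForm (n + 1) u q =
      C b * (C (u 0 1) * X + C (u 1 1)) *
        ∑ q ∈ Finset.range (n + 1), C (f.coeff q) * binaryForm n u q := by
    rw [Finset.sum_range_succ, Polynomial.coeff_C_mul,
      Polynomial.coeff_eq_zero_of_natDegree_lt (Nat.lt_succ_of_le hf), Finset.mul_sum]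
    simp only [mul_zero, map_zero, zero_mul, add_zero]
    refine Finset.sum_congr rfl fun q hq => ?_
    have hq' : q ≤ n := Nat.lt_succ_iff.mp (Finset.mem_range.mp hq)
    rw [Polynomial.coeff_C_mul, binaryForm, binaryForm, Nat.succ_sub hq', pow_succ]
    simp only [map_mul]
    ring
  have h2 : ∑ q ∈ Finset.range (n + 2), C ((C a * X * f).coeff q) * binaryForm (n + 1) u q =
      C a * (C (u 0 0) * X + C (u 1 0)) *
        ∑ q ∈ Finset.range (n + 1), C (f.coeff q) * binaryForm n u q := by
    rw [Finset.sum_range_succ', mul_assoc, Polynomial.coeff_C_mul, Polynomial.coeff_X_mul_zero,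
      Finset.mul_sum]
    simp only [mul_zero, map_zero, zero_mul, add_zero]
    refine Finset.sum_congr rfl fun q hq => ?_
    rw [Polynomial.coeff_C_mul, Polynomial.coeff_X_mul, binaryForm, binaryForm,
      Nat.succ_sub_succ, pow_succ]
    simp only [map_mul]
    ring
  rw [add_mul (C a * X) (C b) f]
  simp only [Polynomial.coeff_add, map_add, add_mul (C _) (C _) (binaryForm _ _ _),
    Finset.sum_add_distrib]
  rw [h1, h2]
  ring

theorem natDegree_linear_pow_mul (a b c d : ℂ) (r s : ℕ) :
    ((C a * X + C b) ^ r * (C c * X + C d) ^ s : Polynomial ℂ).natDegree ≤ r + s := by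
  refine Polynomial.natDegree_mul_le.trans (Nat.add_le_add ?_ ?_)
  · simpa using Polynomial.natDegree_pow_le_of_le r (Polynomial.natDegree_linear_le (a := a) (b := b))
  · simpa using Polynomial.natDegree_pow_le_of_le s (Polynomial.natDegree_linear_le (a := c) (b := d))

theorem sum_binaryForm_linear_pow (u : Matrix (Fin 2) (Fin 2) ℂ) (a b c d : ℂ) (r s : ℕ) :
    ∑ q ∈ Finset.range (r + s + 1),
        C (((C a * X + C b) ^ r * (C c * X + C d) ^ s : Polynomial ℂ).coeff q) *
          binaryForm (r + s) u q =
      (C a * (C (u 0 0) * X + C (u 1 0)) + C b * (C (u 0 1) * X + C (u 1 1))) ^ r *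
        (C c * (C (u 0 0) * X + C (u 1 0)) + C d * (C (u 0 1) * X + C (u 1 1))) ^ s := by
  induction r with
  | zero =>
    induction s with
    | zero => simp [binaryForm]
    | succ s ih =>
      have h := sum_binaryForm_mul (0 + s) u c d _ (natDegree_linear_pow_mul a b c d 0 s)
      rw [ih] at h
      have e : ((C a * X + C b) ^ 0 * (C c * X + C d) ^ (s + 1) : Polynomial ℂ) =
          (C c * X + C d) * ((C a * X + C b) ^ 0 * (C c * X + C d) ^ s) := by ring
      rw [e]
      refine h.trans ?_
      ring
  | succ r ih =>
    have h := sum_binaryForm_mul (r + s) u a b _ (natDegree_linear_pow_mul a b c d r s)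
    rw [ih] at h
    have e : ((C a * X + C b) ^ (r + 1) * (C c * X + C d) ^ s : Polynomial ℂ) =
        (C a * X + C b) * ((C a * X + C b) ^ r * (C c * X + C d) ^ s) := by ring
    rw [e, show r + 1 + s = r + s + 1 by ring]
    refine h.trans ?_
    ring

theorem binaryForm_mul (n : ℕ) (u v : Matrix (Fin 2) (Fin 2) ℂ) (q : ℕ) (hq : q ≤ n) :
    binaryForm n (u * v) q =
      ∑ r ∈ Finset.range (n + 1), C ((binaryForm n v q).coeff r) * binaryForm n u r := by
  obtain ⟨s, rfl⟩ := Nat.exists_eq_add_of_le hq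
  have h := sum_binaryForm_linear_pow u (v 0 0) (v 1 0) (v 0 1) (v 1 1) q s
  have e : binaryForm (q + s) v q =
      (C (v 0 0) * X + C (v 1 0)) ^ q * (C (v 0 1) * X + C (v 1 1)) ^ s := by
    simp [binaryForm]
  rw [e, h]
  simp only [binaryForm, Matrix.mul_apply, Fin.sum_univ_two, map_add, map_mul,
    Nat.add_sub_cancel_left]
  congr 2 <;> ring

theorem spinMatrix_mul (n : ℕ) (u v : Matrix (Fin 2) (Fin 2) ℂ) :
    spinMatrix n (u * v) = spinMatrix n u * spinMatrix n v := by
  ext p q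
  rw [Matrix.mul_apply]
  simp only [spinMatrix, Matrix.of_apply]
  rw [binaryForm_mul n u v q (Nat.lt_succ_iff.mp q.2), Finset.sum_range, Polynomial.finsetSum_coeff,
    Finset.mul_sum]
  refine Finset.sum_congr rfl fun r _ => ?_
  have hr : ((√(formWeight n r) : ℝ) : ℂ) ≠ 0 := by exact_mod_cast sqrt_formWeight_ne_zero n r
  have hq : ((√(formWeight n q) : ℝ) : ℂ) ≠ 0 := by exact_mod_cast sqrt_formWeight_ne_zero n q
  rw [Polynomial.coeff_C_mul]
  push_cast
  field_simp

/-- The standard representation `D_j` of `SU(2)` of spin `j = n/2`. -/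
def spinRep (n : ℕ) : Representation ℂ SU2 (SpinSpace n) where
  toFun u := Matrix.toEuclideanLin (spinMatrix n (u : Matrix (Fin 2) (Fin 2) ℂ))
  map_one' := by
    rw [Submonoid.coe_one, spinMatrix_one]
    ext x i
    simp
  map_mul' u v := by
    rw [Submonoid.coe_mul, spinMatrix_mul]
    ext x i
    simp [Matrix.mulVec_mulVec]

/-- The representation `(u, v) ↦ D_{j₁}(u) ⊗ D_{j₂}(v)` of `SU(2) × SU(2)`. -/
def pairRep (a b : ℕ) : Representation ℂ (SU2 × SU2) (SpinSpace a ⊗[ℂ] SpinSpace b) :=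
  Representation.tprod ((spinRep a).comp (MonoidHom.fst SU2 SU2))
    ((spinRep b).comp (MonoidHom.snd SU2 SU2))

/-- The diagonal representation `u ↦ D_{j₁}(u) ⊗ D_{j₂}(u)` of `SU(2)`. -/
def diagRep (a b : ℕ) : Representation ℂ SU2 (SpinSpace a ⊗[ℂ] SpinSpace b) :=
  Representation.tprod (spinRep a) (spinRep b)

/-- The part of the representation `ρ` of type `σ`: the span of the images of all intertwining maps
from `σ` to `ρ`.  For irreducible `σ` this is the isotypic component. -/
def isotypicPart {G V W : Type*} [Group G] [AddCommGroup V] [Module ℂ V] [AddCommGroup W]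
    [Module ℂ W] (σ : Representation ℂ G V) (ρ : Representation ℂ G W) : Submodule ℂ W :=
  ⨆ T : Representation.IntertwiningMap σ ρ, LinearMap.range T.toLinearMap

/-- The orthogonal projector onto a subspace of a finite-dimensional Hilbert space. -/
def orthProj {W : Type*} [NormedAddCommGroup W] [InnerProductSpace ℂ W] [FiniteDimensional ℂ W]
    (U : Submodule ℂ W) : W →ₗ[ℂ] W :=
  U.starProjection.toLinearMap

/-- The triangle condition `k ∈ ⟨j₁, j₂⟩ = {|j₁ - j₂|, |j₁ - j₂| + 1, ..., j₁ + j₂}`. -/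
def Triangle (a b c : ℕ) : Prop := Even (a + b + c) ∧ a ≤ b + c ∧ b ≤ a + c ∧ c ≤ a + b

instance (a b c : ℕ) : Decidable (Triangle a b c) := by unfold Triangle; infer_instance

/-- The set `⟨j₁, j₂⟩` of spins in the Clebsch-Gordan series of `j₁` and `j₂`. -/
def coupled (a b : ℕ) : Finset ℕ := (Finset.range (a + b + 1)).filter (Triangle a b)

/-- The two-spin projector `P^k_{j₁j₂}`: the orthogonal projector of `H_{j₁} ⊗ H_{j₂}` onto its
spin-`k` subspace under the diagonal action of `SU(2)`. -/
def twoSpinProj (a b k : ℕ) :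
    (SpinSpace a ⊗[ℂ] SpinSpace b) →ₗ[ℂ] (SpinSpace a ⊗[ℂ] SpinSpace b) :=
  orthProj (isotypicPart (spinRep k) (diagRep a b))

/-- The quasicharacter `χ^k_{j₁j₂}(u, v) = Tr (P^k_{j₁j₂} (D_{j₁}(u) ⊗ D_{j₂}(v)))`. -/
def quasichar (a b k : ℕ) (u v : SU2) : ℂ :=
  LinearMap.trace ℂ _ (twoSpinProj a b k ∘ₗ pairRep a b (u, v))

/-- The four-fold space `H_{j₁} ⊗ H_{j₂} ⊗ H_{j₁'} ⊗ H_{j₂'}`. -/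
abbrev FourSpace (a b a' b' : ℕ) : Type :=
  (SpinSpace a ⊗[ℂ] SpinSpace b) ⊗[ℂ] (SpinSpace a' ⊗[ℂ] SpinSpace b')

/-- The representation `(u, v) ↦ D_{j₁}(u) ⊗ D_{j₂}(v) ⊗ D_{j₁'}(u) ⊗ D_{j₂'}(v)`. -/
def fourRep (a b a' b' : ℕ) : Representation ℂ (SU2 × SU2) (FourSpace a b a' b') :=
  Representation.tprod (pairRep a b) (pairRep a' b')

/-- The orthogonal projector of the four-fold space onto the copy of `H_{J₁} ⊗ H_{J₂}` in it, as a
representation of `SU(2) × SU(2)`. -/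
def copyProj (a b a' b' J₁ J₂ : ℕ) : FourSpace a b a' b' →ₗ[ℂ] FourSpace a b a' b' :=
  orthProj (W := FourSpace a b a' b') (isotypicPart (pairRep J₁ J₂) (fourRep a b a' b'))

/-- The grand projector `P^K_{J₁J₂}` on the four-fold space: the orthogonal projector onto the
spin-`K` subspace of the copy of `H_{J₁} ⊗ H_{J₂}` in it, that is, onto the image of the range of
the two-spin projector `P^K_{J₁J₂}` under the `SU(2) × SU(2)`-intertwining maps from
`H_{J₁} ⊗ H_{J₂}` to the four-fold space. -/
def grandProj (a b a' b' J₁ J₂ K : ℕ) : FourSpace a b a' b' →ₗ[ℂ] FourSpace a b a' b' :=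
  orthProj (W := FourSpace a b a' b') (⨆ T : Representation.IntertwiningMap (pairRep J₁ J₂) (fourRep a b a' b'),
    (LinearMap.range (twoSpinProj J₁ J₂ K)).map T.toLinearMap)

/-- The part of an operator on the four-fold space that is block diagonal with respect to the
decomposition of that space into the copies of the `H_{J₁} ⊗ H_{J₂}`. -/
def blockDiagPart (a b a' b' : ℕ) (A : FourSpace a b a' b' →ₗ[ℂ] FourSpace a b a' b') :
    FourSpace a b a' b' →ₗ[ℂ] FourSpace a b a' b' :=
  ∑ J₁ ∈ coupled a a', ∑ J₂ ∈ coupled b b',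
    copyProj a b a' b' J₁ J₂ ∘ₗ A ∘ₗ copyProj a b a' b' J₁ J₂

/-- The Wigner `3j` symbol `(j₁ j₂ j₃; m₁ m₂ m₃)`, by Racah's formula, for `j₁ = a/2`, `j₂ = b/2`,
`j₃ = c/2` and `p = j₁ + m₁`, `q = j₂ + m₂`, `r = j₃ + m₃`.  With `S = j₁ + j₂ + j₃`,
`j₁ + j₂ - j₃ = S - c`, `j₃ - j₂ + m₁ = p - (S - c)`, `j₃ - j₁ - m₂ = (b - q) - (S - c)` and
`j₁ - j₂ - m₃ = S - b - r`; the sum runs over the `s` for which all six factorials have nonnegative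
arguments.  The symbol is zero unless the triangle condition and `m₁ + m₂ + m₃ = 0` hold. -/
def threeJ (a b c : ℕ) (p : Fin (a + 1)) (q : Fin (b + 1)) (r : Fin (c + 1)) : ℝ :=
  if Triangle a b c ∧ 2 * ((p : ℕ) + q + r) = a + b + c then
    let S : ℕ := (a + b + c) / 2
    (-1 : ℝ) ^ ((S : ℤ) - b - (r : ℕ)) *
      √(((S - c)! * (S - b)! * (S - a)! : ℝ) / ((S + 1)! : ℝ)) *
      √((p : ℕ)! * (a - p)! * (q : ℕ)! * (b - q)! * (r : ℕ)! * (c - r)! : ℝ) *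
      ∑ s ∈ (Finset.range (S + 1)).filter (fun s =>
          s ≤ S - c ∧ s ≤ a - p ∧ s ≤ q ∧ S - c ≤ p + s ∧ S - c ≤ b - q + s),
        (-1 : ℝ) ^ s / ((s)! * (S - c - s)! * (a - p - s)! * (q - s)! *
          (p + s - (S - c))! * (b - q + s - (S - c))! : ℝ)
  else 0

/-- The `9j` symbol with rows `(a₁ a₂ a₃)`, `(b₁ b₂ b₃)`, `(c₁ c₂ c₃)` (as Dynkin labels): the sum,
over all nine magnetic quantum numbers, of the product of the `3j` symbols of the rows and of the
columns. -/
def nineJ (a₁ a₂ a₃ b₁ b₂ b₃ c₁ c₂ c₃ : ℕ) : ℝ :=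
  ∑ p₁ : Fin (a₁ + 1), ∑ p₂ : Fin (a₂ + 1), ∑ p₃ : Fin (a₃ + 1),
  ∑ q₁ : Fin (b₁ + 1), ∑ q₂ : Fin (b₂ + 1), ∑ q₃ : Fin (b₃ + 1),
  ∑ r₁ : Fin (c₁ + 1), ∑ r₂ : Fin (c₂ + 1), ∑ r₃ : Fin (c₃ + 1),
    threeJ a₁ a₂ a₃ p₁ p₂ p₃ * threeJ b₁ b₂ b₃ q₁ q₂ q₃ * threeJ c₁ c₂ c₃ r₁ r₂ r₃ *
    (threeJ a₁ b₁ c₁ p₁ q₁ r₁ * threeJ a₂ b₂ c₂ p₂ q₂ r₂ * threeJ a₃ b₃ c₃ p₃ q₃ r₃)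

/-- The structure constant `[J₁][J₂][k][k'] {j₁ j₂ k; j₁' j₂' k'; J₁ J₂ K}²`. -/
def structConst (j₁ j₂ k j₁' j₂' k' J₁ J₂ K : ℕ) : ℂ :=
  (((J₁ + 1 : ℝ) * (J₂ + 1) * (k + 1) * (k' + 1) *
    nineJ j₁ j₂ k j₁' j₂' k' J₁ J₂ K ^ 2 : ℝ) : ℂ)

end SpinRecoupling

end

noncomputable section

namespace SpinRecoupling

/-! ### Unitarity of the spin representations -/

/-! The mechanism is Schur's lemma, applied twice, together with the identification of one scalar as
a `9j` symbol.

Spin `c` occurs in `a ⊗ b` at most once, so the isotypic projector is `C C†` for an equivariant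
isometry `C = coupling a b c`, and these projectors sum to the identity. Likewise `H_{J₁} ⊗ H_{J₂}`
occurs in the four-fold space exactly once, through an isometry `E = embed` built from two
couplings. Hence `copyProj = E E†`, and the grand projector is `E P^K E†` (`copyProj_eq`,
`grandProj_eq`).

Put `R = (C_k ⊗ C_{k'})† E`, the recoupling operator. A diagonal block of `P^k ⊗ P^{k'}` is then `E
(R† R) E†`. Since `R` commutes with the diagonal `SU(2)`, it sends the spin-`K` part of `J₁ ⊗ J₂` to
a multiple of the spin-`K` part of `k ⊗ k'`. A trace computed in ladder bases gives that multiple: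
`√([k][k'][J₁][J₂])` times the `9j` symbol (`trace_recoupling`, `recoupling_comp_coupling`). So `R†
R = ∑ c^K P^K` (`recouplingAdj_comp_recoupling`), which is the first claim.

For the traces, `fourRep` preserves each copy, so off-diagonal blocks contribute nothing
(`trace_eq_trace_blockDiagPart`). The product of quasicharacters is the trace of the tensor product,
and `E` carries the grand projector's trace back to a quasicharacter (`trace_grandProj`).

The concrete input is that the `3j` symbols are the normalised coefficients of an `SL(2)`-invariant
product of brackets (`threeJ_eq`). This gives their invariance, and one binomial sum gives their
norm. As an invariant tensor, a `3j` symbol couples the conjugate of spin `c`; since conjugation on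
`SU(2)` is inner, composing with one fixed group element makes the coupling equivariant. -/

theorem eq_zero_of_sum_mul_pow_eq_zero {n : ℕ} (c : Fin (n + 1) → ℂ)
    (h : ∀ x : ℂ, ∑ p, c p * x ^ (p : ℕ) = 0) (p : Fin (n + 1)) : c p = 0 := by
  have h0 : (∑ p, C (c p) * X ^ (p : ℕ) : Polynomial ℂ) = 0 := by
    refine Polynomial.funext fun x => ?_
    simpa [Polynomial.eval_finsetSum] using h x
  have h1 := congrArg (fun f : Polynomial ℂ => f.coeff p) h0
  simpa [Polynomial.finsetSum_coeff, Polynomial.coeff_X_pow, Fin.val_inj] using h1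

theorem natDegree_binaryForm_le (n : ℕ) (u : Matrix (Fin 2) (Fin 2) ℂ) (q : ℕ) (hq : q ≤ n) :
    (binaryForm n u q).natDegree ≤ n := by
  refine (natDegree_linear_pow_mul _ _ _ _ q (n - q)).trans ?_
  omega

theorem sum_coeff_binaryForm_mul_pow (n : ℕ) (u : Matrix (Fin 2) (Fin 2) ℂ) (q : ℕ) (hq : q ≤ n)
    (x : ℂ) :
    ∑ p : Fin (n + 1), (binaryForm n u q).coeff p * x ^ (p : ℕ) =
      (u 0 0 * x + u 1 0) ^ q * (u 0 1 * x + u 1 1) ^ (n - q) := by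
  have h := Polynomial.eval_eq_sum_range' (Nat.lt_succ_of_le (natDegree_binaryForm_le n u q hq)) x
  rw [Finset.sum_range] at h
  rw [← h]
  simp [binaryForm]

theorem sum_choose_mul_coeff_binaryForm (n : ℕ) (u : Matrix (Fin 2) (Fin 2) ℂ) (x t : ℂ) :
    ∑ q : Fin (n + 1), (∑ p : Fin (n + 1),
        (n.choose q * (binaryForm n u q).coeff p) * x ^ (p : ℕ)) * t ^ (q : ℕ) =
      (t * (u 0 0 * x + u 1 0) + (u 0 1 * x + u 1 1)) ^ n := by
  rw [add_pow, Finset.sum_range]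
  refine Finset.sum_congr rfl fun q _ => ?_
  simp_rw [mul_assoc]
  rw [← Finset.mul_sum, sum_coeff_binaryForm_mul_pow n u q (Nat.lt_succ_iff.mp q.2), mul_pow]
  ring

/-- Both sides are the coefficient of `x^p t^q` in `(t (u₀₀ x + u₁₀) + (u₀₁ x + u₁₁))^n`, which is
unchanged when `x, t` are swapped and `u` is transposed. -/
theorem choose_mul_coeff_binaryForm_transpose (n : ℕ) (u : Matrix (Fin 2) (Fin 2) ℂ)
    (p q : Fin (n + 1)) :
    (n.choose q : ℂ) * (binaryForm n u q).coeff p =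
      n.choose p * (binaryForm n u.transpose p).coeff q := by
  rw [← sub_eq_zero]
  revert p
  refine eq_zero_of_sum_mul_pow_eq_zero _ fun x => ?_
  revert q
  refine eq_zero_of_sum_mul_pow_eq_zero _ fun t => ?_
  have h1 := sum_choose_mul_coeff_binaryForm n u x t
  have h2 := sum_choose_mul_coeff_binaryForm n u.transpose t x
  have h3 : (t * (u 0 0 * x + u 1 0) + (u 0 1 * x + u 1 1)) ^ n =
      (x * (u.transpose 0 0 * t + u.transpose 1 0) +
        (u.transpose 0 1 * t + u.transpose 1 1)) ^ n := by
    simp only [Matrix.transpose_apply]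
    ring
  simp only [sub_mul, Finset.sum_sub_distrib]
  rw [h1, h3, ← h2, sub_eq_zero]
  simp_rw [Finset.sum_mul]
  rw [Finset.sum_comm]
  refine Finset.sum_congr rfl fun _ _ => Finset.sum_congr rfl fun _ _ => ?_
  ring

theorem formWeight_pos (n p : ℕ) : 0 < formWeight n p := by
  unfold formWeight; positivity

theorem choose_mul_formWeight (n p : ℕ) (hp : p ≤ n) :
    (n.choose p : ℝ) * formWeight n p = n ! := by
  rw [formWeight, ← mul_assoc]
  exact_mod_cast Nat.choose_mul_factorial_mul_factorial hp

/-- The weight `p! (n-p)!` is `n!` divided by the binomial coefficient, so the normalisation by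
square roots turns the weighted symmetry of the coefficients into a plain transpose. Unitarity of
the representation follows. -/
theorem spinMatrix_transpose (n : ℕ) (u : Matrix (Fin 2) (Fin 2) ℂ) :
    spinMatrix n u.transpose = (spinMatrix n u).transpose := by
  ext q p
  simp only [spinMatrix, Matrix.of_apply, Matrix.transpose_apply]
  have h := choose_mul_coeff_binaryForm_transpose n u p q
  have hp : ((√(formWeight n p) : ℝ) : ℂ) ≠ 0 := by exact_mod_cast sqrt_formWeight_ne_zero n p
  have hq : ((√(formWeight n q) : ℝ) : ℂ) ≠ 0 := by exact_mod_cast sqrt_formWeight_ne_zero n q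
  have hp2 : ((√(formWeight n p) : ℝ) : ℂ) ^ 2 = (formWeight n p : ℂ) := by
    exact_mod_cast Real.sq_sqrt (formWeight_pos n p).le
  have hq2 : ((√(formWeight n q) : ℝ) : ℂ) ^ 2 = (formWeight n q : ℂ) := by
    exact_mod_cast Real.sq_sqrt (formWeight_pos n q).le
  have cp : (n.choose p : ℂ) * (formWeight n p : ℂ) = (n ! : ℂ) := by
    exact_mod_cast congrArg (fun x : ℝ => (x : ℂ))
      (choose_mul_formWeight n p (Nat.lt_succ_iff.mp p.2))
  have cq : (n.choose q : ℂ) * (formWeight n q : ℂ) = (n ! : ℂ) := by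
    exact_mod_cast congrArg (fun x : ℝ => (x : ℂ))
      (choose_mul_formWeight n q (Nat.lt_succ_iff.mp q.2))
  have hn : (n ! : ℂ) ≠ 0 := by exact_mod_cast n.factorial_ne_zero
  push_cast
  field_simp
  rw [hp2, hq2]
  apply mul_left_cancel₀ hn
  linear_combination (-(formWeight n p : ℂ) * formWeight n q) * h +
    (formWeight n p * (binaryForm n u q).coeff p) * cq
    - (formWeight n q * (binaryForm n u.transpose p).coeff q) * cp

theorem spinMatrix_map_conj (n : ℕ) (u : Matrix (Fin 2) (Fin 2) ℂ) :
    spinMatrix n (u.map (starRingEnd ℂ)) = (spinMatrix n u).map (starRingEnd ℂ) := by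
  ext p q
  have h : binaryForm n (u.map (starRingEnd ℂ)) q = (binaryForm n u q).map (starRingEnd ℂ) := by
    simp [binaryForm]
  simp [spinMatrix, h]

theorem spinMatrix_conjTranspose (n : ℕ) (u : Matrix (Fin 2) (Fin 2) ℂ) :
    spinMatrix n u.conjTranspose = (spinMatrix n u).conjTranspose := by
  have h : u.conjTranspose = (u.map (starRingEnd ℂ)).transpose := by ext; simp
  rw [h, spinMatrix_transpose, spinMatrix_map_conj]
  ext; simp

theorem adjoint_spinRep (n : ℕ) (u : SU2) :
    LinearMap.adjoint (spinRep n u) = spinRep n u⁻¹ := by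
  change LinearMap.adjoint (Matrix.toEuclideanLin (spinMatrix n (u : Matrix (Fin 2) (Fin 2) ℂ))) =
    Matrix.toEuclideanLin (spinMatrix n ((u⁻¹ : SU2) : Matrix (Fin 2) (Fin 2) ℂ))
  rw [← Matrix.toEuclideanLin_conjTranspose_eq_adjoint, ← spinMatrix_conjTranspose]
  rfl

/-! ### Schur's lemma for the spin representations -/

/-- The element `diag(z, z̄)` of `SU(2)`. -/
def torusElement (z : ℂ) (hz : ‖z‖ = 1) : SU2 :=
  ⟨!![z, 0; 0, starRingEnd ℂ z], by
    have h : z * starRingEnd ℂ z = 1 := by rw [Complex.mul_conj']; simp [hz]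
    rw [Matrix.mem_specialUnitaryGroup_iff, Matrix.mem_unitaryGroup_iff]
    refine ⟨?_, by simp [Matrix.det_fin_two, h]⟩
    ext i j
    fin_cases i <;> fin_cases j <;>
      simp [Matrix.mul_apply, Fin.sum_univ_two, Matrix.star_apply, h, mul_comm _ z]⟩

/-- The rotation with cosine `3/5` and sine `4/5`, all of whose entries are nonzero. -/
def rotationElement : SU2 :=
  ⟨!![3 / 5, -4 / 5; 4 / 5, 3 / 5], by
    rw [Matrix.mem_specialUnitaryGroup_iff, Matrix.mem_unitaryGroup_iff]
    refine ⟨?_, by rw [Matrix.det_fin_two]; norm_num⟩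
    ext i j
    fin_cases i <;> fin_cases j <;>
      norm_num [Matrix.mul_apply, Fin.sum_univ_two, Matrix.star_apply, map_ofNat]⟩

theorem spinMatrix_diagonal (n : ℕ) (z z' : ℂ) (p q : Fin (n + 1)) :
    spinMatrix n !![z, 0; 0, z'] p q = if p = q then z ^ (q : ℕ) * z' ^ (n - q) else 0 := by
  have h : binaryForm n !![z, 0; 0, z'] q = C (z ^ (q : ℕ) * z' ^ (n - q)) * X ^ (q : ℕ) := by
    simp [binaryForm, mul_pow]; ring
  simp only [spinMatrix, Matrix.of_apply, h, Polynomial.coeff_C_mul, Polynomial.coeff_X_pow]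
  by_cases hpq : p = q
  · subst hpq
    simp [sqrt_formWeight_ne_zero n p]
  · have : (p : ℕ) ≠ q := fun e => hpq (Fin.ext e)
    simp [hpq, this]

/-- The form with `q = 0` is a pure power of one linear form, so its coefficients are single
binomial terms. Schur's lemma needs one row and one column free of zeros. -/
theorem spinMatrix_apply_zero_ne_zero (n : ℕ) (u : Matrix (Fin 2) (Fin 2) ℂ) (h01 : u 0 1 ≠ 0)
    (h11 : u 1 1 ≠ 0) (p : Fin (n + 1)) : spinMatrix n u p 0 ≠ 0 := by
  have hp : p ≤ n := Nat.lt_succ_iff.mp p.2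
  have h : (binaryForm n u 0).coeff p = u 0 1 ^ (p : ℕ) * u 1 1 ^ (n - p) * n.choose p := by
    have : binaryForm n u 0 = ((X + C (u 1 1)) ^ n).comp (C (u 0 1) * X) := by simp [binaryForm]
    rw [this, Polynomial.comp_C_mul_X_coeff, Polynomial.coeff_X_add_C_pow]
    ring
  have h2 : (n.choose p : ℂ) ≠ 0 := by exact_mod_cast (Nat.choose_pos hp).ne'
  have hp : ((√(formWeight n p) : ℝ) : ℂ) ≠ 0 := by exact_mod_cast sqrt_formWeight_ne_zero n p
  have hq : ((√(formWeight n 0) : ℝ) : ℂ) ≠ 0 := by exact_mod_cast sqrt_formWeight_ne_zero n 0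
  simp only [spinMatrix, Matrix.of_apply, Fin.val_zero, h]
  push_cast
  exact mul_ne_zero (div_ne_zero hp hq)
    (mul_ne_zero (mul_ne_zero (pow_ne_zero _ h01) (pow_ne_zero _ h11)) h2)

theorem spinMatrix_zero_apply_ne_zero (n : ℕ) (u : Matrix (Fin 2) (Fin 2) ℂ) (h10 : u 1 0 ≠ 0)
    (h11 : u 1 1 ≠ 0) (q : Fin (n + 1)) : spinMatrix n u 0 q ≠ 0 := by
  have h := spinMatrix_apply_zero_ne_zero n u.transpose h10 h11 q
  rwa [spinMatrix_transpose] at h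

section Schur

variable {k c : ℕ} {M : Matrix (Fin (c + 1)) (Fin (k + 1)) ℂ}

/-- An intertwiner commutes with the diagonal torus, so it can only connect equal weights `2p - c =
2q - k`. -/
theorem weight_eq_of_intertwines
    (hM : ∀ u : SU2, M * spinMatrix k (u : Matrix (Fin 2) (Fin 2) ℂ) =
      spinMatrix c (u : Matrix (Fin 2) (Fin 2) ℂ) * M)
    {p : Fin (c + 1)} {q : Fin (k + 1)} (h : M p q ≠ 0) : 2 * (p : ℕ) + k = 2 * q + c := by
  -- One torus element suffices: both exponents compared below are at most `2(k + c)`, so a root of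
  -- unity of this order separates them.
  have hN : 2 * (k + c) + 1 ≠ 0 := by omega
  have hζ := Complex.isPrimitiveRoot_exp _ hN
  set z := Complex.exp (2 * Real.pi * Complex.I / ((2 * (k + c) + 1 : ℕ) : ℂ)) with hz
  have hz1 : ‖z‖ = 1 := hζ.norm'_eq_one hN
  have hzz : z * starRingEnd ℂ z = 1 := by rw [Complex.mul_conj']; simp [hz1]
  have e := congrFun (congrFun (hM (torusElement z hz1)) p) q
  simp only [torusElement, Matrix.mul_apply, spinMatrix_diagonal] at e
  simp only [mul_ite, mul_zero, Finset.sum_ite_eq', Finset.mem_univ, if_true, ite_mul, zero_mul,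
    Finset.sum_ite_eq] at e
  rw [mul_comm] at e
  have e' := mul_right_cancel₀ h e
  have hp : (p : ℕ) ≤ c := Nat.lt_succ_iff.mp p.2
  have hq : (q : ℕ) ≤ k := Nat.lt_succ_iff.mp q.2
  have key : ∀ m r : ℕ, r ≤ m → z ^ r * starRingEnd ℂ z ^ (m - r) * z ^ m = z ^ (2 * r) := by
    intro m r hr
    obtain ⟨s, rfl⟩ := Nat.exists_eq_add_of_le hr
    calc z ^ r * starRingEnd ℂ z ^ (r + s - r) * z ^ (r + s)
        = z ^ (2 * r) * (z * starRingEnd ℂ z) ^ s := by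
          rw [Nat.add_sub_cancel_left]; ring
      _ = _ := by rw [hzz, one_pow, mul_one]
  have e2 : z ^ (2 * (q : ℕ) + c) = z ^ (2 * (p : ℕ) + k) := by
    rw [pow_add, pow_add, ← key k q hq, ← key c p hp, e']
    ring
  exact (hζ.pow_inj (by omega) (by omega) e2).symm

/-- The larger spin has an extreme weight absent from the smaller one, so `M` has a zero row or
column at index `0`. Comparing one entry of `M D = D M` at a rotation with no vanishing entry there
leaves a single term, which forces every entry of `M` to vanish. -/
theorem eq_zero_of_intertwines_of_ne
    (hM : ∀ u : SU2, M * spinMatrix k (u : Matrix (Fin 2) (Fin 2) ℂ) =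
      spinMatrix c (u : Matrix (Fin 2) (Fin 2) ℂ) * M) (hkc : k ≠ c) : M = 0 := by
  have hw := fun p q => weight_eq_of_intertwines hM (p := p) (q := q)
  ext p q
  by_contra h
  have hpq := hw p q h
  rcases lt_or_gt_of_ne hkc with hlt | hlt
  · have e := congrFun (congrFun (hM rotationElement) 0) q
    rw [Matrix.mul_apply, Matrix.mul_apply, Finset.sum_eq_zero, Finset.sum_eq_single p] at e
    · exact mul_ne_zero (spinMatrix_zero_apply_ne_zero c _ (by simp [rotationElement])
        (by simp [rotationElement]) p) h e.symm
    · intro s _ hs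
      by_contra h'
      have := hw s q (right_ne_zero_of_mul h')
      exact hs (Fin.ext (by omega))
    · simp
    · intro s _
      by_contra h'
      have := hw 0 s (left_ne_zero_of_mul h')
      simp at this
      omega
  · have e := congrFun (congrFun (hM rotationElement) p) 0
    rw [Matrix.mul_apply, Matrix.mul_apply, Finset.sum_eq_single q, Finset.sum_eq_zero] at e
    · exact mul_ne_zero h (spinMatrix_apply_zero_ne_zero k _ (by simp [rotationElement])
        (by simp [rotationElement]) q) e
    · intro s _
      by_contra h'
      have := hw s 0 (right_ne_zero_of_mul h')
      simp at this
      omega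
    · intro s _ hs
      by_contra h'
      have := hw p s (left_ne_zero_of_mul h')
      exact hs (Fin.ext (by omega))
    · simp

/-- Weights make `M` diagonal; the column `0` of `M D = D M`, all of whose entries of `D` are
nonzero, makes the diagonal constant. -/
theorem eq_smul_one_of_intertwines {M : Matrix (Fin (c + 1)) (Fin (c + 1)) ℂ}
    (hM : ∀ u : SU2, M * spinMatrix c (u : Matrix (Fin 2) (Fin 2) ℂ) =
      spinMatrix c (u : Matrix (Fin 2) (Fin 2) ℂ) * M) : M = M 0 0 • 1 := by
  have hw : ∀ p q, p ≠ q → M p q = 0 := fun p q hpq => by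
    by_contra h
    have := weight_eq_of_intertwines hM h
    exact hpq (Fin.ext (by omega))
  ext p q
  by_cases hpq : p = q
  · subst hpq
    have e := congrFun (congrFun (hM rotationElement) p) 0
    rw [Matrix.mul_apply, Matrix.mul_apply, Finset.sum_eq_single p, Finset.sum_eq_single 0,
      mul_comm] at e
    · simpa using mul_left_cancel₀ (spinMatrix_apply_zero_ne_zero c _ (by simp [rotationElement])
        (by simp [rotationElement]) p) e
    · intro s _ hs; simp [hw s 0 hs]
    · simp
    · intro s _ hs; simp [hw p s hs.symm]
    · simp
  · simp [hw p q hpq, hpq]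

end Schur

theorem spinRep_apply (n : ℕ) (u : SU2) :
    spinRep n u = Matrix.toEuclideanLin (spinMatrix n (u : Matrix (Fin 2) (Fin 2) ℂ)) := rfl

theorem toEuclideanLin_mul {l m n : ℕ} (M : Matrix (Fin l) (Fin m) ℂ)
    (N : Matrix (Fin m) (Fin n) ℂ) :
    Matrix.toEuclideanLin (M * N) = Matrix.toEuclideanLin M ∘ₗ Matrix.toEuclideanLin N := by
  ext x i
  simp [Matrix.mulVec_mulVec]

theorem matrix_intertwines {k c : ℕ} {A : SpinSpace k →ₗ[ℂ] SpinSpace c}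
    (hA : ∀ u, A ∘ₗ spinRep k u = spinRep c u ∘ₗ A) (u : SU2) :
    Matrix.toEuclideanLin.symm A * spinMatrix k (u : Matrix (Fin 2) (Fin 2) ℂ) =
      spinMatrix c (u : Matrix (Fin 2) (Fin 2) ℂ) * Matrix.toEuclideanLin.symm A := by
  apply Matrix.toEuclideanLin.injective
  rw [toEuclideanLin_mul, toEuclideanLin_mul, LinearEquiv.apply_symm_apply]
  exact hA u

theorem spinRep_schur_ne {k c : ℕ} (hkc : k ≠ c) {A : SpinSpace k →ₗ[ℂ] SpinSpace c}
    (hA : ∀ u, A ∘ₗ spinRep k u = spinRep c u ∘ₗ A) : A = 0 := by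
  have h := eq_zero_of_intertwines_of_ne (matrix_intertwines hA) hkc
  simpa using h

theorem spinRep_schur {c : ℕ} {A : SpinSpace c →ₗ[ℂ] SpinSpace c}
    (hA : ∀ u, A ∘ₗ spinRep c u = spinRep c u ∘ₗ A) : ∃ z : ℂ, A = z • LinearMap.id := by
  have h := eq_smul_one_of_intertwines (matrix_intertwines hA)
  refine ⟨Matrix.toEuclideanLin.symm A 0 0, ?_⟩
  have h1 : Matrix.toEuclideanLin (1 : Matrix (Fin (c + 1)) (Fin (c + 1)) ℂ) = LinearMap.id := by
    ext; simp
  conv_lhs => rw [← LinearEquiv.apply_symm_apply Matrix.toEuclideanLin A, h, map_smul, h1]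

/-! ### The `3j` symbols as coefficients of an invariant form -/

/-- The coefficient of `x₁^p y₁^(α+γ-p) x₂^q y₂^(α+β-q) x₃^r y₃^(β+γ-r)` in
`(x₁y₂ - x₂y₁)^α (x₂y₃ - x₃y₂)^β (x₃y₁ - x₁y₃)^γ`. -/
def invariantCoeff (α β γ p q r : ℕ) : ℝ :=
  ∑ i ∈ Finset.range (α + 1), ∑ j ∈ Finset.range (β + 1), ∑ l ∈ Finset.range (γ + 1),
    if α - i + l = p ∧ i + (β - j) = q ∧ j + (γ - l) = r then
      (-1) ^ (i + j + l) * (α.choose i * β.choose j * γ.choose l : ℝ) else 0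

theorem sum_sum_sum_ite {l m n : ℕ} (a b c : ℕ) (ha : a < l) (hb : b < m) (hc : c < n)
    (t : ℂ) (f : ℕ → ℕ → ℕ → ℂ) :
    ∑ p : Fin l, ∑ q : Fin m, ∑ r : Fin n,
      (if a = p ∧ b = q ∧ c = r then t else 0) * f p q r = t * f a b c := by
  rw [Finset.sum_eq_single ⟨a, ha⟩, Finset.sum_eq_single ⟨b, hb⟩, Finset.sum_eq_single ⟨c, hc⟩]
  · simp
  · intro r _ hr
    rw [if_neg, zero_mul]
    rintro ⟨-, -, h⟩
    exact hr (Fin.ext h.symm)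
  · simp
  · intro q _ hq
    refine Finset.sum_eq_zero fun r _ => ?_
    rw [if_neg, zero_mul]
    rintro ⟨-, h, -⟩
    exact hq (Fin.ext h.symm)
  · simp
  · intro p _ hp
    refine Finset.sum_eq_zero fun q _ => Finset.sum_eq_zero fun r _ => ?_
    rw [if_neg, zero_mul]
    rintro ⟨h, -, -⟩
    exact hp (Fin.ext h.symm)
  · simp

theorem sum_invariantCoeff_mul (α β γ : ℕ) (x₁ y₁ x₂ y₂ x₃ y₃ : ℂ) :
    ∑ p : Fin (α + γ + 1), ∑ q : Fin (α + β + 1), ∑ r : Fin (β + γ + 1),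
      (invariantCoeff α β γ p q r : ℂ) *
        ((x₁ ^ (p : ℕ) * y₁ ^ (α + γ - p)) * (x₂ ^ (q : ℕ) * y₂ ^ (α + β - q)) *
          (x₃ ^ (r : ℕ) * y₃ ^ (β + γ - r))) =
      (x₁ * y₂ - x₂ * y₁) ^ α * (x₂ * y₃ - x₃ * y₂) ^ β * (x₃ * y₁ - x₁ * y₃) ^ γ := by
  -- The negative monomial is put first so that `i`, `j`, `l` count the negative terms, as in
  -- `invariantCoeff`.
  have e1 : (x₁ * y₂ - x₂ * y₁) ^ α = _ :=
    (congrArg (· ^ α) (by ring)).trans (add_pow (-(x₂ * y₁)) (x₁ * y₂) α)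
  have e2 : (x₂ * y₃ - x₃ * y₂) ^ β = _ :=
    (congrArg (· ^ β) (by ring)).trans (add_pow (-(x₃ * y₂)) (x₂ * y₃) β)
  have e3 : (x₃ * y₁ - x₁ * y₃) ^ γ = _ :=
    (congrArg (· ^ γ) (by ring)).trans (add_pow (-(x₁ * y₃)) (x₃ * y₁) γ)
  rw [e1, e2, e3, Finset.sum_mul_sum, Finset.sum_mul]
  simp_rw [Finset.sum_mul, Finset.mul_sum]
  simp only [invariantCoeff, Complex.ofReal_sum, apply_ite Complex.ofReal]
  push_cast
  simp_rw [Finset.sum_mul]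
  have comm : ∀ (F : ℕ → ℕ → ℕ → ℕ → ℕ → ℕ → ℂ),
      ∑ p : Fin (α + γ + 1), ∑ q : Fin (α + β + 1), ∑ r : Fin (β + γ + 1),
        ∑ i ∈ Finset.range (α + 1), ∑ j ∈ Finset.range (β + 1), ∑ l ∈ Finset.range (γ + 1),
          F p q r i j l =
      ∑ i ∈ Finset.range (α + 1), ∑ j ∈ Finset.range (β + 1), ∑ l ∈ Finset.range (γ + 1),
        ∑ p : Fin (α + γ + 1), ∑ q : Fin (α + β + 1), ∑ r : Fin (β + γ + 1), F p q r i j l := by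
    intro F
    simp_rw [Finset.sum_comm (s := Finset.univ) (t := Finset.range _)]
  rw [comm fun p q r i j l =>
    (if α - i + l = p ∧ i + (β - j) = q ∧ j + (γ - l) = r then
      (-1) ^ (i + j + l) * (α.choose i * β.choose j * γ.choose l : ℂ) else 0) *
        ((x₁ ^ p * y₁ ^ (α + γ - p)) * (x₂ ^ q * y₂ ^ (α + β - q)) *
          (x₃ ^ r * y₃ ^ (β + γ - r)))]
  refine Finset.sum_congr rfl fun i hi => Finset.sum_congr rfl fun j hj =>
    Finset.sum_congr rfl fun l hl => ?_
  rw [Finset.mem_range] at hi hj hl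
  rw [sum_sum_sum_ite (α - i + l) (i + (β - j)) (j + (γ - l)) (by omega) (by omega) (by omega) _
    fun p q r => (x₁ ^ p * y₁ ^ (α + γ - p)) * (x₂ ^ q * y₂ ^ (α + β - q)) *
          (x₃ ^ r * y₃ ^ (β + γ - r))]
  obtain ⟨i', rfl⟩ := Nat.exists_eq_add_of_le (Nat.lt_succ_iff.mp hi)
  obtain ⟨j', rfl⟩ := Nat.exists_eq_add_of_le (Nat.lt_succ_iff.mp hj)
  obtain ⟨l', rfl⟩ := Nat.exists_eq_add_of_le (Nat.lt_succ_iff.mp hl)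
  have h1 : i + i' + (l + l') - (i + i' - i + l) = i + l' := by omega
  have h2 : i + i' + (j + j') - (i + (j + j' - j)) = i' + j := by omega
  have h3 : j + j' + (l + l') - (j + (l + l' - l)) = j' + l := by omega
  rw [h1, h2, h3]
  simp only [Nat.add_sub_cancel_left, neg_mul_eq_neg_mul]
  simp only [mul_pow, neg_pow x₂, neg_pow x₃, neg_pow x₁]
  ring

theorem invariantCoeff_eq_zero {α β γ p q r : ℕ} (h : p + q + r ≠ α + β + γ) :
    invariantCoeff α β γ p q r = 0 := by
  refine Finset.sum_eq_zero fun i hi => Finset.sum_eq_zero fun j hj =>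
    Finset.sum_eq_zero fun l hl => if_neg ?_
  rw [Finset.mem_range] at hi hj hl
  omega

theorem cast_choose_eq_div {m i j : ℕ} (h : i + j = m) :
    (m.choose i : ℝ) = m ! / (i ! * j !) := by
  subst h
  exact Nat.cast_add_choose ℝ

/-- Once `i` is chosen the exponents force `j = i + β - q` and `l = p + i - α`. The triple sum thus
collapses to Racah's single sum with `s = i`; the inequalities on `s` say that `j` and `l` are
admissible. -/
theorem invariantCoeff_eq_sum {α β γ p q r : ℕ} (h : p + q + r = α + β + γ) (hp : p ≤ α + γ)
    (hq : q ≤ α + β) :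
    invariantCoeff α β γ p q r = (α ! * β ! * γ ! : ℝ) * ((-1 : ℝ) ^ ((γ : ℤ) - r) *
      ∑ s ∈ (Finset.range (α + β + γ + 1)).filter (fun s =>
          s ≤ α ∧ s ≤ α + γ - p ∧ s ≤ q ∧ α ≤ p + s ∧ α ≤ α + β - q + s),
        (-1 : ℝ) ^ s / ((s)! * (α - s)! * (α + γ - p - s)! * (q - s)! *
          (p + s - α)! * (α + β - q + s - α)! : ℝ)) := by
  have hf : (Finset.range (α + β + γ + 1)).filter (fun s =>
      s ≤ α ∧ s ≤ α + γ - p ∧ s ≤ q ∧ α ≤ p + s ∧ α ≤ α + β - q + s) =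
      (Finset.range (α + 1)).filter (fun s =>
        s ≤ α ∧ s ≤ α + γ - p ∧ s ≤ q ∧ α ≤ p + s ∧ α ≤ α + β - q + s) := by
    ext s
    simp only [Finset.mem_filter, Finset.mem_range]
    omega
  rw [hf, Finset.sum_filter, Finset.mul_sum, Finset.mul_sum, invariantCoeff]
  refine Finset.sum_congr rfl fun i hi => ?_
  rw [Finset.mem_range] at hi
  split_ifs with hc
  · obtain ⟨h1, h2, h3, h4, h5⟩ := hc
    obtain ⟨j, hj⟩ : ∃ j, i + β = q + j := ⟨i + β - q, by omega⟩
    obtain ⟨l, hl⟩ : ∃ l, p + i = α + l := ⟨p + i - α, by omega⟩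
    rw [Finset.sum_eq_single j, Finset.sum_eq_single l]
    · rw [if_pos (by omega), cast_choose_eq_div (i := i) (j := α - i) (by omega),
        cast_choose_eq_div (i := j) (j := q - i) (by omega),
        cast_choose_eq_div (i := l) (j := α + γ - p - i) (by omega)]
      have e1 : p + i - α = l := by omega
      have e2 : α + β - q + i - α = j := by omega
      -- The exponent of `x₃` gives `γ - r = l - j`, which has the parity of `j + l`.
      have e3 : (-1 : ℝ) ^ ((γ : ℤ) - r) = (-1) ^ (j + l) := by
        have : (γ : ℤ) - r = ((j + l : ℕ) : ℤ) + 2 * (-(j : ℤ)) := by push_cast; omega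
        rw [this, zpow_add₀ (by norm_num), zpow_natCast, zpow_mul]
        norm_num
      rw [e1, e2, e3]
      have : i + j + l = (j + l) + i := by ring
      rw [this, pow_add]
      field_simp
    · intro l' hl' hne
      rw [Finset.mem_range] at hl'
      exact if_neg (by omega)
    · intro hn
      rw [Finset.mem_range] at hn
      omega
    · intro j' hj' hne
      rw [Finset.mem_range] at hj'
      refine Finset.sum_eq_zero fun l' hl' => if_neg ?_
      rw [Finset.mem_range] at hl'
      omega
    · intro hn
      rw [Finset.mem_range] at hn
      omega
  · simp only [mul_zero]
    refine Finset.sum_eq_zero fun j hj => Finset.sum_eq_zero fun l hl => if_neg ?_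
    rw [Finset.mem_range] at hj hl
    omega

/-- The factor between the `3j` symbol and the normalised coefficient of the invariant form. -/
def threeJNorm (α β γ : ℕ) : ℝ :=
  √((α ! * γ ! * β ! : ℝ) / ((α + β + γ + 1)! : ℝ)) / (α ! * β ! * γ !)

/-- The bracket exponents are `α = S - c`, `β = S - a`, `γ = S - b`, where `S` is half the sum of
the labels. -/
theorem triangle_iff {a b c : ℕ} :
    Triangle a b c ↔ ∃ α β γ, a = α + γ ∧ b = α + β ∧ c = β + γ := by
  constructor
  · rintro ⟨⟨S, hS⟩, h1, h2, h3⟩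
    exact ⟨S - c, S - a, S - b, by omega, by omega, by omega⟩
  · rintro ⟨α, β, γ, rfl, rfl, rfl⟩
    exact ⟨⟨α + β + γ, by ring⟩, by omega, by omega, by omega⟩

theorem threeJ_eq (α β γ : ℕ) (p : Fin (α + γ + 1)) (q : Fin (α + β + 1)) (r : Fin (β + γ + 1)) :
    threeJ (α + γ) (α + β) (β + γ) p q r = threeJNorm α β γ *
      (√(formWeight (α + γ) p) * √(formWeight (α + β) q) * √(formWeight (β + γ) r)) *
        invariantCoeff α β γ p q r := by
  have hp : (p : ℕ) ≤ α + γ := Nat.lt_succ_iff.mp p.2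
  have hq : (q : ℕ) ≤ α + β := Nat.lt_succ_iff.mp q.2
  unfold threeJ
  have hS : (α + γ + (α + β) + (β + γ)) / 2 = α + β + γ := by omega
  split_ifs with h
  · have hpqr : (p : ℕ) + q + r = α + β + γ := by omega
    rw [invariantCoeff_eq_sum hpqr hp hq]
    simp only [hS]
    have e1 : α + β + γ - (β + γ) = α := by omega
    have e2 : α + β + γ - (α + β) = γ := by omega
    have e3 : α + β + γ - (α + γ) = β := by omega
    have e4 : ((α + β + γ : ℕ) : ℤ) - ((α + β : ℕ) : ℤ) - ((r : ℕ) : ℤ) = (γ : ℤ) - (r : ℕ) := by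
      push_cast; ring
    rw [e1, e2, e3, e4, threeJNorm]
    rw [← Real.sqrt_mul (formWeight_pos _ _).le, ← Real.sqrt_mul (by
      have := formWeight_pos (α + γ) p; have := formWeight_pos (α + β) q; positivity)]
    simp only [formWeight]
    field_simp
  · rw [invariantCoeff_eq_zero, mul_zero]
    intro h'
    exact h ⟨triangle_iff.2 ⟨α, β, γ, rfl, rfl, rfl⟩, by omega⟩

/-! ### Invariance of the `3j` tensor -/

theorem eq_of_sum_mul_pow_eq {l m n : ℕ} {f g : Fin (l + 1) → Fin (m + 1) → Fin (n + 1) → ℂ}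
    (h : ∀ x y z : ℂ, ∑ p, ∑ q, ∑ r, f p q r * (x ^ (p : ℕ) * y ^ (q : ℕ) * z ^ (r : ℕ)) =
      ∑ p, ∑ q, ∑ r, g p q r * (x ^ (p : ℕ) * y ^ (q : ℕ) * z ^ (r : ℕ))) : f = g := by
  funext p q r
  rw [← sub_eq_zero]
  revert r
  refine eq_zero_of_sum_mul_pow_eq_zero _ fun z => ?_
  revert q
  refine eq_zero_of_sum_mul_pow_eq_zero _ fun y => ?_
  revert p
  refine eq_zero_of_sum_mul_pow_eq_zero _ fun x => ?_
  rw [← sub_eq_zero.2 (h x y z)]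
  simp only [← Finset.sum_sub_distrib, Finset.sum_mul]
  refine Finset.sum_congr rfl fun _ _ => Finset.sum_congr rfl fun _ _ =>
    Finset.sum_congr rfl fun _ _ => ?_
  ring

/-- A linear substitution multiplies each bracket by `det u = 1`, so the product of brackets is
unchanged; its coefficients are compared after setting every `y` to `1`. -/
theorem sum_invariantCoeff_coeff (α β γ : ℕ) (u : Matrix (Fin 2) (Fin 2) ℂ) (hu : u.det = 1)
    (p' : Fin (α + γ + 1)) (q' : Fin (α + β + 1)) (r' : Fin (β + γ + 1)) :
    ∑ p : Fin (α + γ + 1), ∑ q : Fin (α + β + 1), ∑ r : Fin (β + γ + 1),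
      (invariantCoeff α β γ p q r : ℂ) * ((binaryForm (α + γ) u p).coeff p' *
        (binaryForm (α + β) u q).coeff q' * (binaryForm (β + γ) u r).coeff r') =
      invariantCoeff α β γ p' q' r' := by
  revert p' q' r'
  suffices h : (fun (p' : Fin (α + γ + 1)) (q' : Fin (α + β + 1)) (r' : Fin (β + γ + 1)) =>
      ∑ p : Fin (α + γ + 1), ∑ q : Fin (α + β + 1), ∑ r : Fin (β + γ + 1),
      (invariantCoeff α β γ p q r : ℂ) * ((binaryForm (α + γ) u p).coeff p' *
        (binaryForm (α + β) u q).coeff q' * (binaryForm (β + γ) u r).coeff r')) =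
      fun (p' : Fin (α + γ + 1)) (q' : Fin (α + β + 1)) (r' : Fin (β + γ + 1)) =>
        (invariantCoeff α β γ p' q' r' : ℂ) from
    fun p' q' r' => congrFun (congrFun (congrFun h p') q') r'
  refine eq_of_sum_mul_pow_eq fun x y z => ?_
  have h1 := sum_invariantCoeff_mul α β γ x 1 y 1 z 1
  have h2 := sum_invariantCoeff_mul α β γ (u 0 0 * x + u 1 0) (u 0 1 * x + u 1 1)
    (u 0 0 * y + u 1 0) (u 0 1 * y + u 1 1) (u 0 0 * z + u 1 0) (u 0 1 * z + u 1 1)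
  have hdet : ∀ s t : ℂ, (u 0 0 * s + u 1 0) * (u 0 1 * t + u 1 1) -
      (u 0 0 * t + u 1 0) * (u 0 1 * s + u 1 1) = s * 1 - t * 1 := by
    intro s t
    rw [Matrix.det_fin_two] at hu
    linear_combination (s - t) * hu
  rw [hdet, hdet, hdet, ← h1] at h2
  simp only [one_pow, mul_one] at h2
  rw [← h2]
  simp_rw [Finset.sum_mul]
  have comm : ∀ (F : Fin (α + γ + 1) → Fin (α + β + 1) → Fin (β + γ + 1) →
      Fin (α + γ + 1) → Fin (α + β + 1) → Fin (β + γ + 1) → ℂ),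
      ∑ p', ∑ q', ∑ r', ∑ p, ∑ q, ∑ r, F p' q' r' p q r =
        ∑ p, ∑ q, ∑ r, ∑ p', ∑ q', ∑ r', F p' q' r' p q r := by
    intro F
    have := Finset.sum_comm (s := Finset.univ) (t := Finset.univ)
      (f := fun (P : Fin (α + γ + 1) × Fin (α + β + 1) × Fin (β + γ + 1))
        (Q : Fin (α + γ + 1) × Fin (α + β + 1) × Fin (β + γ + 1)) =>
          F P.1 P.2.1 P.2.2 Q.1 Q.2.1 Q.2.2)
    simpa only [Fintype.sum_prod_type] using this
  rw [comm]
  refine Finset.sum_congr rfl fun p _ => Finset.sum_congr rfl fun q _ =>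
    Finset.sum_congr rfl fun r _ => ?_
  rw [← sum_coeff_binaryForm_mul_pow _ u p (Nat.lt_succ_iff.mp p.2),
    ← sum_coeff_binaryForm_mul_pow _ u q (Nat.lt_succ_iff.mp q.2),
    ← sum_coeff_binaryForm_mul_pow _ u r (Nat.lt_succ_iff.mp r.2),
    Finset.sum_mul_sum, Finset.sum_mul, Finset.mul_sum]
  refine Finset.sum_congr rfl fun _ _ => ?_
  rw [Finset.sum_mul, Finset.mul_sum]
  refine Finset.sum_congr rfl fun _ _ => ?_
  rw [Finset.mul_sum, Finset.mul_sum]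
  refine Finset.sum_congr rfl fun _ _ => ?_
  ring

theorem threeJ_eq_zero {a b c : ℕ} (h : ¬ Triangle a b c) (p : Fin (a + 1)) (q : Fin (b + 1))
    (r : Fin (c + 1)) : threeJ a b c p q r = 0 := by
  rw [threeJ, if_neg fun hT => h hT.1]

/-- The `3j` symbols form an invariant tensor. -/
theorem sum_spinMatrix_mul_threeJ (a b c : ℕ) (u : Matrix (Fin 2) (Fin 2) ℂ) (hu : u.det = 1)
    (p' : Fin (a + 1)) (q' : Fin (b + 1)) (r' : Fin (c + 1)) :
    ∑ p, ∑ q, ∑ r, spinMatrix a u p' p * spinMatrix b u q' q * spinMatrix c u r' r *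
      (threeJ a b c p q r : ℂ) = threeJ a b c p' q' r' := by
  by_cases h : Triangle a b c
  · obtain ⟨α, β, γ, rfl, rfl, rfl⟩ := triangle_iff.1 h
    rw [threeJ_eq]
    push_cast
    rw [← sum_invariantCoeff_coeff α β γ u hu p' q' r']
    simp_rw [Finset.mul_sum]
    refine Finset.sum_congr rfl fun p _ => Finset.sum_congr rfl fun q _ =>
      Finset.sum_congr rfl fun r _ => ?_
    rw [threeJ_eq]
    have hp : ((√(formWeight (α + γ) p) : ℝ) : ℂ) ≠ 0 := by
      exact_mod_cast sqrt_formWeight_ne_zero _ p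
    have hq : ((√(formWeight (α + β) q) : ℝ) : ℂ) ≠ 0 := by
      exact_mod_cast sqrt_formWeight_ne_zero _ q
    have hr : ((√(formWeight (β + γ) r) : ℝ) : ℂ) ≠ 0 := by
      exact_mod_cast sqrt_formWeight_ne_zero _ r
    simp only [spinMatrix, Matrix.of_apply]
    push_cast
    field_simp
  · simp [threeJ_eq_zero h]

/-! ### Normalisation of the `3j` symbols -/

/-- Coefficient of `X^k` in `(1 - X)^{-(m+1)} (1 - X)^{-(n+1)} = (1 - X)^{-(m+n+2)}`. -/
theorem sum_antidiagonal_add_choose_mul (m n k : ℕ) :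
    ∑ x ∈ Finset.HasAntidiagonal.antidiagonal k, ((m + x.1).choose m : ℝ) * (n + x.2).choose n =
      (m + n + 1 + k).choose (m + n + 1) := by
  have h := congrArg Units.val (PowerSeries.invOneSubPow_add ℝ (m + 1) (n + 1))
  rw [Units.val_mul, show m + 1 + (n + 1) = m + n + 1 + 1 by ring] at h
  simp only [PowerSeries.invOneSubPow_val_succ_eq_mk_add_choose] at h
  have h2 := congrArg (PowerSeries.coeff k) h
  rw [PowerSeries.coeff_mul] at h2
  simpa using h2.symm

/-- At the top power of `x₃` the second and third brackets contribute only `(-x₃ y₂)^β (x₃ y₁)^γ`,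
leaving the binomial expansion of the first. -/
theorem invariantCoeff_last (α β γ p q : ℕ) :
    invariantCoeff α β γ p q (β + γ) =
      if p + q = α then (-1) ^ (q + β) * (α.choose q : ℝ) else 0 := by
  split_ifs with h
  · rw [invariantCoeff, Finset.sum_eq_single q, Finset.sum_eq_single β, Finset.sum_eq_single 0]
    · rw [if_pos (by omega)]
      simp
    · intro l hl hne
      rw [Finset.mem_range] at hl
      exact if_neg (by omega)
    · simp
    · intro j hj hne
      rw [Finset.mem_range] at hj
      refine Finset.sum_eq_zero fun l hl => if_neg ?_
      rw [Finset.mem_range] at hl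
      omega
    · simp
    · intro i hi hne
      rw [Finset.mem_range] at hi
      refine Finset.sum_eq_zero fun j hj => Finset.sum_eq_zero fun l hl => if_neg ?_
      rw [Finset.mem_range] at hj hl
      omega
    · intro hn
      rw [Finset.mem_range] at hn
      omega
  · refine Finset.sum_eq_zero fun i hi => Finset.sum_eq_zero fun j hj =>
      Finset.sum_eq_zero fun l hl => if_neg ?_
    rw [Finset.mem_range] at hi hj hl
    omega

theorem sum_fin_sum_fin_eq_sum_antidiagonal {k l m : ℕ} (hl : k ≤ l) (hm : k ≤ m) (f : ℕ → ℕ → ℝ)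
    (hf : ∀ p q, p + q ≠ k → f p q = 0) :
    ∑ p : Fin (l + 1), ∑ q : Fin (m + 1), f p q =
      ∑ x ∈ Finset.HasAntidiagonal.antidiagonal k, f x.1 x.2 := by
  rw [← Finset.sum_range fun p => ∑ q : Fin (m + 1), f p q]
  have e : ∀ p, ∑ q : Fin (m + 1), f p q = ∑ q ∈ Finset.range (m + 1), f p q :=
    fun p => (Finset.sum_range (f p)).symm
  simp_rw [e]
  rw [← Finset.sum_product']
  refine (Finset.sum_subset ?_ ?_).symm
  · rintro ⟨p, q⟩ h
    rw [Finset.HasAntidiagonal.mem_antidiagonal] at h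
    simp only [Finset.mem_product, Finset.mem_range]
    dsimp only at h
    omega
  · rintro ⟨p, q⟩ _ h
    rw [Finset.HasAntidiagonal.mem_antidiagonal] at h
    exact hf p q h

theorem threeJNorm_sq (α β γ : ℕ) :
    threeJNorm α β γ ^ 2 * (α ! * β ! * γ ! * (α + β + γ + 1)!) = 1 := by
  rw [threeJNorm, div_pow, Real.sq_sqrt (by positivity)]
  field_simp

/-- Only the highest weight of the third spin is needed: Schur's lemma fixes the norm at every other
weight. After the factorials cancel, the sum is the negative-binomial convolution above. -/
theorem sum_threeJ_last_sq {a b c : ℕ} (h : Triangle a b c) :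
    ∑ p, ∑ q, threeJ a b c p q (Fin.last c) ^ 2 = 1 / (c + 1 : ℝ) := by
  obtain ⟨α, β, γ, rfl, rfl, rfl⟩ := triangle_iff.1 h
  simp_rw [threeJ_eq, mul_pow, Real.sq_sqrt (formWeight_pos _ _).le, Fin.val_last]
  rw [sum_fin_sum_fin_eq_sum_antidiagonal (k := α) (by omega) (by omega)
    (fun p q => threeJNorm α β γ ^ 2 * (formWeight (α + γ) p * formWeight (α + β) q *
      formWeight (β + γ) (β + γ)) * invariantCoeff α β γ p q (β + γ) ^ 2)
    (fun p q hpq => by rw [invariantCoeff_last, if_neg hpq]; simp)]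
  have key : ∀ x ∈ Finset.HasAntidiagonal.antidiagonal α,
      threeJNorm α β γ ^ 2 * (formWeight (α + γ) x.1 * formWeight (α + β) x.2 *
        formWeight (β + γ) (β + γ)) * invariantCoeff α β γ x.1 x.2 (β + γ) ^ 2 =
      (threeJNorm α β γ ^ 2 * ((β + γ)! * (α !) ^ 2 * β ! * γ !)) *
        (((β + x.1).choose β : ℝ) * (γ + x.2).choose γ) := by
    rintro ⟨p, q⟩ hpq
    rw [Finset.HasAntidiagonal.mem_antidiagonal] at hpq
    dsimp only at hpq ⊢
    rw [invariantCoeff_last, if_pos hpq, mul_pow, ← pow_mul, mul_comm (q + β) 2, pow_mul,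
      neg_one_sq, one_pow, one_mul, cast_choose_eq_div (i := q) (j := p) (m := α) (by omega),
      cast_choose_eq_div (i := β) (j := p) rfl, cast_choose_eq_div (i := γ) (j := q) rfl]
    simp only [formWeight]
    rw [show α + γ - p = γ + q by omega, show α + β - q = β + p by omega, Nat.sub_self]
    simp only [Nat.factorial_zero, Nat.cast_one]
    field_simp
  rw [Finset.sum_congr rfl key, ← Finset.mul_sum, sum_antidiagonal_add_choose_mul,
    cast_choose_eq_div (i := β + γ + 1) (j := α) rfl]
  have hN := threeJNorm_sq α β γ
  rw [show β + γ + 1 + α = α + β + γ + 1 by ring, Nat.factorial_succ (β + γ)]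
  push_cast
  field_simp
  field_simp at hN
  linear_combination hN

theorem linearMap_sum_comp {ι U V W : Type*} [AddCommGroup U] [Module ℂ U] [AddCommGroup V]
    [Module ℂ V] [AddCommGroup W] [Module ℂ W] (s : Finset ι) (f : ι → V →ₗ[ℂ] W) (g : U →ₗ[ℂ] V) :
    (∑ i ∈ s, f i) ∘ₗ g = ∑ i ∈ s, f i ∘ₗ g := by
  ext; simp

theorem linearMap_comp_sum {ι U V W : Type*} [AddCommGroup U] [Module ℂ U] [AddCommGroup V]
    [Module ℂ V] [AddCommGroup W] [Module ℂ W] (s : Finset ι) (f : ι → U →ₗ[ℂ] V) (g : V →ₗ[ℂ] W) :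
    g ∘ₗ (∑ i ∈ s, f i) = ∑ i ∈ s, g ∘ₗ f i := by
  ext; simp

/-! ### Clebsch-Gordan isometries -/

/-- The element of `SU(2)` whose conjugation action is complex conjugation. -/
def conjElement : SU2 :=
  ⟨!![0, -1; 1, 0], by
    rw [Matrix.mem_specialUnitaryGroup_iff, Matrix.mem_unitaryGroup_iff]
    refine ⟨?_, by simp [Matrix.det_fin_two]⟩
    ext i j
    fin_cases i <;> fin_cases j <;>
      simp [Matrix.mul_apply, Fin.sum_univ_two, Matrix.star_apply]⟩

/-- Conjugation by `conjElement`, that is, complex conjugation of the matrix entries. -/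
def twist (u : SU2) : SU2 := conjElement * u * conjElement⁻¹

theorem det_coe (u : SU2) : (u : Matrix (Fin 2) (Fin 2) ℂ).det = 1 :=
  (Matrix.mem_specialUnitaryGroup_iff.1 u.2).2

theorem star_coe_eq_adjugate (u : SU2) :
    star (u : Matrix (Fin 2) (Fin 2) ℂ) = (u : Matrix (Fin 2) (Fin 2) ℂ).adjugate := by
  have h1 : (u : Matrix (Fin 2) (Fin 2) ℂ) * star (u : Matrix (Fin 2) (Fin 2) ℂ) = 1 :=
    Matrix.mem_unitaryGroup_iff.1 (Matrix.mem_specialUnitaryGroup_iff.1 u.2).1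
  have h2 := Matrix.adjugate_mul (u : Matrix (Fin 2) (Fin 2) ℂ)
  rw [det_coe, one_smul] at h2
  exact (left_inv_eq_right_inv h2 h1).symm

/-- For `u` in `SU(2)` the adjoint is the adjugate, so the entries satisfy `u₁₁ = ū₀₀` and `u₁₀ =
-ū₀₁`; conjugation by a quarter turn then has the effect of complex conjugation. -/
theorem coe_twist (u : SU2) :
    ((twist u : SU2) : Matrix (Fin 2) (Fin 2) ℂ) =
      (u : Matrix (Fin 2) (Fin 2) ℂ).map (starRingEnd ℂ) := by
  have h := star_coe_eq_adjugate u
  have e : ((twist u : SU2) : Matrix (Fin 2) (Fin 2) ℂ) =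
    !![0, -1; 1, 0] * (u : Matrix (Fin 2) (Fin 2) ℂ) * star !![0, -1; 1, 0] := rfl
  rw [e]
  rw [Matrix.adjugate_fin_two] at h
  have h00 := congrFun (congrFun h 0) 0
  have h01 := congrFun (congrFun h 0) 1
  have h10 := congrFun (congrFun h 1) 0
  have h11 := congrFun (congrFun h 1) 1
  simp [Matrix.star_apply] at h00 h01 h10 h11
  ext i j
  fin_cases i <;> fin_cases j <;>
    simp [Matrix.mul_apply, Matrix.vecMul, dotProduct, Fin.sum_univ_two, Matrix.star_apply, h00,
      h01, h10, h11]

theorem twist_surjective (u : SU2) : ∃ v, twist v = u :=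
  ⟨conjElement⁻¹ * u * conjElement, by simp [twist, mul_assoc]⟩

theorem twist_inv (u : SU2) : twist u⁻¹ = (twist u)⁻¹ := by simp [twist, mul_assoc]

/-- The ladder basis `|j, m⟩`. -/
def ladder (n : ℕ) : OrthonormalBasis (Fin (n + 1)) ℂ (SpinSpace n) :=
  EuclideanSpace.basisFun _ ℂ

theorem spinRep_ladder (n : ℕ) (u : SU2) (q : Fin (n + 1)) :
    spinRep n u (ladder n q) =
      ∑ p, spinMatrix n (u : Matrix (Fin 2) (Fin 2) ℂ) p q • ladder n p := by
  ext i
  simp [spinRep_apply, ladder, Pi.single_apply]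

/-- The Clebsch-Gordan map from spin `c` to the tensor product of the spins `a` and `b`. -/
def clebschGordan (a b c : ℕ) : SpinSpace c →ₗ[ℂ] SpinSpace a ⊗[ℂ] SpinSpace b :=
  (ladder c).toBasis.constr ℂ fun r =>
    ((√(c + 1 : ℝ) : ℝ) : ℂ) • ∑ p, ∑ q, (threeJ a b c p q r : ℂ) • (ladder a p ⊗ₜ ladder b q)

theorem clebschGordan_ladder (a b c : ℕ) (r : Fin (c + 1)) :
    clebschGordan a b c (ladder c r) =
      ((√(c + 1 : ℝ) : ℝ) : ℂ) •
        ∑ p, ∑ q, (threeJ a b c p q r : ℂ) • (ladder a p ⊗ₜ ladder b q) := by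
  rw [clebschGordan, ← (ladder c).coe_toBasis, Module.Basis.constr_basis]

theorem repr_clebschGordan_ladder (a b c : ℕ) (p : Fin (a + 1)) (q : Fin (b + 1))
    (r : Fin (c + 1)) :
    ((ladder a).tensorProduct (ladder b)).repr (clebschGordan a b c (ladder c r)) (p, q) =
      ((√(c + 1 : ℝ) * threeJ a b c p q r : ℝ) : ℂ) := by
  simp only [clebschGordan_ladder, map_smul, map_sum, PiLp.smul_apply, WithLp.ofLp_sum,
    Finset.sum_apply, OrthonormalBasis.tensorProduct_repr_tmul_apply, OrthonormalBasis.repr_self,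
    PiLp.single_apply]
  simp

theorem sum_conj_spinMatrix_mul (n : ℕ) (u : SU2) (r s : Fin (n + 1)) :
    ∑ t, starRingEnd ℂ (spinMatrix n (u : Matrix (Fin 2) (Fin 2) ℂ) t r) *
      spinMatrix n (u : Matrix (Fin 2) (Fin 2) ℂ) t s = if r = s then 1 else 0 := by
  have h1 : star (u : Matrix (Fin 2) (Fin 2) ℂ) * (u : Matrix (Fin 2) (Fin 2) ℂ) = 1 :=
    Matrix.mem_unitaryGroup_iff'.1 (Matrix.mem_specialUnitaryGroup_iff.1 u.2).1
  have h2 := congrArg (spinMatrix n) h1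
  rw [spinMatrix_mul, spinMatrix_one, Matrix.star_eq_conjTranspose, spinMatrix_conjTranspose] at h2
  have h3 := congrFun (congrFun h2 r) s
  rw [Matrix.mul_apply, Matrix.one_apply] at h3
  exact h3

/-- Unitarity moves the third Wigner matrix of the invariance identity to the other side, where it
appears conjugated. -/
theorem sum_threeJ_mul_spinMatrix (a b c : ℕ) (u : SU2) (p' : Fin (a + 1)) (q' : Fin (b + 1))
    (r : Fin (c + 1)) :
    ∑ p, ∑ q, (threeJ a b c p q r : ℂ) * (spinMatrix a (u : Matrix (Fin 2) (Fin 2) ℂ) p' p *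
        spinMatrix b (u : Matrix (Fin 2) (Fin 2) ℂ) q' q) =
      ∑ r', starRingEnd ℂ (spinMatrix c (u : Matrix (Fin 2) (Fin 2) ℂ) r' r) *
        threeJ a b c p' q' r' := by
  symm
  calc _ = ∑ r', ∑ p, ∑ q, ∑ s, starRingEnd ℂ (spinMatrix c (u : Matrix (Fin 2) (Fin 2) ℂ) r' r) *
      (spinMatrix a (u : Matrix (Fin 2) (Fin 2) ℂ) p' p *
        spinMatrix b (u : Matrix (Fin 2) (Fin 2) ℂ) q' q *
        spinMatrix c (u : Matrix (Fin 2) (Fin 2) ℂ) r' s * (threeJ a b c p q s : ℂ)) := by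
        refine Finset.sum_congr rfl fun r' _ => ?_
        rw [← sum_spinMatrix_mul_threeJ a b c (u : Matrix (Fin 2) (Fin 2) ℂ) (det_coe u) p' q' r']
        simp only [Finset.mul_sum]
    _ = _ := ?_
  rw [Finset.sum_comm]
  refine Finset.sum_congr rfl fun p _ => ?_
  rw [Finset.sum_comm]
  refine Finset.sum_congr rfl fun q _ => ?_
  rw [Finset.sum_comm]
  have h : ∀ s, ∑ t, starRingEnd ℂ (spinMatrix c (u : Matrix (Fin 2) (Fin 2) ℂ) t r) *
      (spinMatrix a (u : Matrix (Fin 2) (Fin 2) ℂ) p' p *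
        spinMatrix b (u : Matrix (Fin 2) (Fin 2) ℂ) q' q *
        spinMatrix c (u : Matrix (Fin 2) (Fin 2) ℂ) t s * (threeJ a b c p q s : ℂ)) =
      (if r = s then 1 else 0) * ((threeJ a b c p q s : ℂ) *
        (spinMatrix a (u : Matrix (Fin 2) (Fin 2) ℂ) p' p *
        spinMatrix b (u : Matrix (Fin 2) (Fin 2) ℂ) q' q)) := by
    intro s
    rw [← sum_conj_spinMatrix_mul c u r s, Finset.sum_mul]
    refine Finset.sum_congr rfl fun t _ => ?_
    ring
  simp_rw [h]
  simp

theorem diagRep_apply (a b : ℕ) (u : SU2) :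
    diagRep a b u = TensorProduct.map (spinRep a u) (spinRep b u) := rfl

theorem pairRep_apply (a b : ℕ) (u v : SU2) :
    pairRep a b (u, v) = TensorProduct.map (spinRep a u) (spinRep b v) := rfl

/-- The bare `3j` map treats its source as the conjugate representation; the conjugate Wigner matrix
of `u` is the Wigner matrix of `twist u`. -/
theorem diagRep_comp_clebschGordan (a b c : ℕ) (u : SU2) :
    diagRep a b u ∘ₗ clebschGordan a b c = clebschGordan a b c ∘ₗ spinRep c (twist u) := by
  refine (ladder c).toBasis.ext fun r => ?_
  rw [OrthonormalBasis.coe_toBasis, LinearMap.comp_apply, LinearMap.comp_apply,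
    clebschGordan_ladder, spinRep_ladder, coe_twist, spinMatrix_map_conj, diagRep_apply]
  simp only [map_smul, map_sum, clebschGordan_ladder, TensorProduct.map_tmul, spinRep_ladder,
    TensorProduct.sum_tmul, TensorProduct.tmul_sum, TensorProduct.smul_tmul_smul, Matrix.map_apply,
    Finset.smul_sum, smul_smul]
  have h := sum_threeJ_mul_spinMatrix a b c u
  calc _ = ∑ p', ∑ q', (((√(c + 1 : ℝ) : ℝ) : ℂ) * ∑ p, ∑ q, (threeJ a b c p q r : ℂ) *
            (spinMatrix a (u : Matrix (Fin 2) (Fin 2) ℂ) p' p *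
              spinMatrix b (u : Matrix (Fin 2) (Fin 2) ℂ) q' q)) •
            (ladder a p' ⊗ₜ[ℂ] ladder b q') := by
        simp only [Finset.mul_sum, Finset.sum_smul]
        have := Finset.sum_comm (s := Finset.univ) (t := Finset.univ)
          (f := fun (P : Fin (a + 1) × Fin (b + 1)) (Q : Fin (a + 1) × Fin (b + 1)) =>
            (((√(c + 1 : ℝ) : ℝ) : ℂ) * ((threeJ a b c P.1 P.2 r : ℂ) *
            (spinMatrix a (u : Matrix (Fin 2) (Fin 2) ℂ) Q.1 P.1 *
              spinMatrix b (u : Matrix (Fin 2) (Fin 2) ℂ) Q.2 P.2))) •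
            (ladder a Q.1 ⊗ₜ[ℂ] ladder b Q.2))
        simp only [Fintype.sum_prod_type] at this
        rw [← this]
        refine Finset.sum_congr rfl fun _ _ => Finset.sum_congr rfl fun _ _ => ?_
        rw [Finset.sum_comm]
        simp only [mul_assoc]
    _ = _ := by
        simp only [h, Finset.mul_sum, Finset.sum_smul]
        conv_rhs => rw [Finset.sum_comm]
        refine Finset.sum_congr rfl fun _ _ => ?_
        conv_rhs => rw [Finset.sum_comm]
        refine Finset.sum_congr rfl fun _ _ => Finset.sum_congr rfl fun _ _ => ?_
        rw [mul_left_comm]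

theorem adjoint_diagRep (a b : ℕ) (u : SU2) :
    LinearMap.adjoint (diagRep a b u) = diagRep a b u⁻¹ := by
  rw [diagRep_apply, TensorProduct.adjoint_map, adjoint_spinRep, adjoint_spinRep, diagRep_apply]

theorem adjoint_clebschGordan_comp_diagRep (a b c : ℕ) (u : SU2) :
    LinearMap.adjoint (clebschGordan a b c) ∘ₗ diagRep a b u =
      spinRep c (twist u) ∘ₗ LinearMap.adjoint (clebschGordan a b c) := by
  have h := congrArg LinearMap.adjoint (diagRep_comp_clebschGordan a b c u⁻¹)
  rw [LinearMap.adjoint_comp, LinearMap.adjoint_comp, adjoint_diagRep, adjoint_spinRep,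
    twist_inv, inv_inv, inv_inv] at h
  exact h

theorem adjoint_clebschGordan_comp_intertwines (a b c c' : ℕ) (u : SU2) :
    (LinearMap.adjoint (clebschGordan a b c') ∘ₗ clebschGordan a b c) ∘ₗ spinRep c u =
      spinRep c' u ∘ₗ (LinearMap.adjoint (clebschGordan a b c') ∘ₗ clebschGordan a b c) := by
  obtain ⟨v, rfl⟩ := twist_surjective u
  rw [LinearMap.comp_assoc, ← diagRep_comp_clebschGordan, ← LinearMap.comp_assoc,
    adjoint_clebschGordan_comp_diagRep, LinearMap.comp_assoc]

theorem adjoint_clebschGordan_comp_of_ne (a b : ℕ) {c c' : ℕ} (h : c ≠ c') :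
    LinearMap.adjoint (clebschGordan a b c') ∘ₗ clebschGordan a b c = 0 :=
  spinRep_schur_ne h (adjoint_clebschGordan_comp_intertwines a b c c')

theorem adjoint_clebschGordan_comp_self {a b c : ℕ} (h : Triangle a b c) :
    LinearMap.adjoint (clebschGordan a b c) ∘ₗ clebschGordan a b c = LinearMap.id := by
  -- Schur's lemma leaves one scalar, read off as the squared norm of the image of the highest
  -- ladder vector; the factor `√(c + 1)` in `clebschGordan` makes it `1`.
  obtain ⟨z, hz⟩ := spinRep_schur (adjoint_clebschGordan_comp_intertwines a b c c)
  have h1 : inner ℂ (ladder c (Fin.last c))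
      ((LinearMap.adjoint (clebschGordan a b c) ∘ₗ clebschGordan a b c) (ladder c (Fin.last c))) =
        1 := by
    rw [LinearMap.comp_apply, LinearMap.adjoint_inner_right,
      ← ((ladder a).tensorProduct (ladder b)).repr.inner_map_map, PiLp.inner_apply,
      Fintype.sum_prod_type]
    have e : ∀ p q, inner ℂ (((ladder a).tensorProduct (ladder b)).repr
        (clebschGordan a b c (ladder c (Fin.last c))) (p, q))
        (((ladder a).tensorProduct (ladder b)).repr
          (clebschGordan a b c (ladder c (Fin.last c))) (p, q)) =
        (((c + 1 : ℝ) * threeJ a b c p q (Fin.last c) ^ 2 : ℝ) : ℂ) := by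
      intro p q
      rw [repr_clebschGordan_ladder, RCLike.inner_apply, Complex.conj_ofReal, ← Complex.ofReal_mul]
      congr 1
      rw [← sq, mul_pow, Real.sq_sqrt (by positivity)]
    simp_rw [e, ← Complex.ofReal_sum, ← Finset.mul_sum]
    rw [sum_threeJ_last_sq h]
    have : (c + 1 : ℝ) ≠ 0 := by positivity
    field_simp
    simp
  rw [hz] at h1 ⊢
  have h2 : z = 1 := by simpa using h1
  rw [h2, one_smul]

/-! ### Completeness of the Clebsch-Gordan series -/

theorem mem_coupled {a b c : ℕ} : c ∈ coupled a b ↔ Triangle a b c := by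
  simp only [coupled, Finset.mem_filter, Finset.mem_range, and_iff_right_iff_imp]
  rintro ⟨-, -, -, h⟩
  omega

theorem coupled_comm (a b : ℕ) : coupled a b = coupled b a := by
  ext c
  simp only [mem_coupled, Triangle, add_comm b a]
  tauto

theorem sum_coupled_add_one (a b : ℕ) : ∑ c ∈ coupled a b, (c + 1) = (a + 1) * (b + 1) := by
  wlog h : a ≤ b generalizing a b
  · rw [coupled_comm, this b a (by omega), mul_comm]
  obtain ⟨d, rfl⟩ := Nat.exists_eq_add_of_le h
  -- With `d = b - a`, the coupled labels are `d, d + 2, ..., d + 2a`.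
  have h1 : ∑ c ∈ coupled a (a + d), (c + 1) = ∑ i ∈ Finset.range (a + 1), (d + 2 * i + 1) := by
    symm
    refine Finset.sum_bij (fun i _ => d + 2 * i) ?_ ?_ ?_ ?_
    · intro i hi
      rw [Finset.mem_range] at hi
      rw [mem_coupled]
      exact ⟨⟨a + d + i, by ring⟩, by omega, by omega, by omega⟩
    · intro i _ j _ hij
      omega
    · intro c hc
      rw [mem_coupled] at hc
      obtain ⟨⟨S, hS⟩, h1, h2, h3⟩ := hc
      exact ⟨S - (a + d), by rw [Finset.mem_range]; omega, by omega⟩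
    · intro i _; rfl
  rw [h1]
  clear h1 h
  have h2 : ∀ n, ∑ i ∈ Finset.range n, (d + 2 * i + 1) = n * (n + d) := by
    intro n
    induction n with
    | zero => simp
    | succ n ih => rw [Finset.sum_range_succ, ih]; ring
  rw [h2]; ring

/-- The sum `Q` is idempotent by orthogonality, and its trace is the full dimension. So `1 - Q` is
an idempotent of trace zero, hence zero. -/
theorem sum_clebschGordan_comp_adjoint (a b : ℕ) :
    ∑ c ∈ coupled a b, clebschGordan a b c ∘ₗ LinearMap.adjoint (clebschGordan a b c) =
      LinearMap.id := by
  set Q := ∑ c ∈ coupled a b, clebschGordan a b c ∘ₗ LinearMap.adjoint (clebschGordan a b c)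
    with hQ
  have hidem : IsIdempotentElem Q := by
    change Q ∘ₗ Q = Q
    conv_rhs => rw [hQ]
    conv_lhs => rw [hQ]
    rw [linearMap_sum_comp]
    refine Finset.sum_congr rfl fun c hc => ?_
    rw [linearMap_comp_sum, Finset.sum_eq_single c]
    · rw [LinearMap.comp_assoc, ← LinearMap.comp_assoc (clebschGordan a b c).adjoint,
        adjoint_clebschGordan_comp_self (mem_coupled.1 hc), LinearMap.id_comp]
    · intro c' _ hne
      rw [LinearMap.comp_assoc, ← LinearMap.comp_assoc (clebschGordan a b c').adjoint,
        adjoint_clebschGordan_comp_of_ne a b hne, LinearMap.zero_comp, LinearMap.comp_zero]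
    · exact fun h => absurd hc h
  have htr : LinearMap.trace ℂ _ Q = ((a + 1) * (b + 1) : ℕ) := by
    rw [hQ, map_sum, ← sum_coupled_add_one, Nat.cast_sum]
    refine Finset.sum_congr rfl fun c hc => ?_
    rw [LinearMap.trace_comp_comm', adjoint_clebschGordan_comp_self (mem_coupled.1 hc),
      LinearMap.trace_id]
    simp
  have h0 : (1 : Module.End ℂ (SpinSpace a ⊗[ℂ] SpinSpace b)) - Q = 0 := by
    refine LinearMap.IsIdempotentElem.eq_zero_of_trace_eq_zero hidem.one_sub ?_
    rw [map_sub, htr, LinearMap.trace_one, Module.finrank_tensorProduct]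
    simp
  exact (sub_eq_zero.1 h0).symm

/-! ### Projectors onto isotypic subspaces -/

theorem orthProj_range {V W : Type*} [NormedAddCommGroup V] [InnerProductSpace ℂ V]
    [FiniteDimensional ℂ V] [NormedAddCommGroup W] [InnerProductSpace ℂ W] [FiniteDimensional ℂ W]
    {G : V →ₗ[ℂ] W} (hG : LinearMap.adjoint G ∘ₗ G = LinearMap.id) :
    orthProj (LinearMap.range G) = G ∘ₗ LinearMap.adjoint G := by
  ext x
  refine (Submodule.eq_starProjection_of_mem_of_inner_eq_zero (K := LinearMap.range G)
    ⟨LinearMap.adjoint G x, rfl⟩ ?_)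
  rintro _ ⟨y, rfl⟩
  rw [← LinearMap.adjoint_inner_left, map_sub]
  have : ∀ z, LinearMap.adjoint G (G z) = z := fun z => LinearMap.congr_fun hG z
  simp [this]

/-- The equivariant Clebsch-Gordan map from spin `c` to the tensor product of the spins `a`
and `b`. -/
def coupling (a b c : ℕ) : SpinSpace c →ₗ[ℂ] SpinSpace a ⊗[ℂ] SpinSpace b :=
  clebschGordan a b c ∘ₗ spinRep c conjElement

theorem spinRep_comp (n : ℕ) (u v : SU2) : spinRep n u ∘ₗ spinRep n v = spinRep n (u * v) :=
  (map_mul (spinRep n) u v).symm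

theorem spinRep_one (n : ℕ) : spinRep n 1 = LinearMap.id := map_one (spinRep n)

theorem diagRep_comp_coupling (a b c : ℕ) (u : SU2) :
    diagRep a b u ∘ₗ coupling a b c = coupling a b c ∘ₗ spinRep c u := by
  rw [coupling, ← LinearMap.comp_assoc, diagRep_comp_clebschGordan, LinearMap.comp_assoc,
    LinearMap.comp_assoc, spinRep_comp, spinRep_comp, twist, inv_mul_cancel_right]

theorem adjoint_coupling_comp_diagRep (a b c : ℕ) (u : SU2) :
    LinearMap.adjoint (coupling a b c) ∘ₗ diagRep a b u =
      spinRep c u ∘ₗ LinearMap.adjoint (coupling a b c) := by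
  have h := congrArg LinearMap.adjoint (diagRep_comp_coupling a b c u⁻¹)
  rw [LinearMap.adjoint_comp, LinearMap.adjoint_comp, adjoint_diagRep, adjoint_spinRep,
    inv_inv] at h
  exact h

theorem coupling_comp_adjoint (a b c : ℕ) :
    coupling a b c ∘ₗ LinearMap.adjoint (coupling a b c) =
      clebschGordan a b c ∘ₗ LinearMap.adjoint (clebschGordan a b c) := by
  rw [coupling, LinearMap.adjoint_comp, adjoint_spinRep, LinearMap.comp_assoc,
    ← LinearMap.comp_assoc _ _ (spinRep c _), spinRep_comp, mul_inv_cancel, spinRep_one,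
    LinearMap.id_comp]

theorem adjoint_coupling_comp_self {a b c : ℕ} (h : Triangle a b c) :
    LinearMap.adjoint (coupling a b c) ∘ₗ coupling a b c = LinearMap.id := by
  rw [coupling, LinearMap.adjoint_comp, adjoint_spinRep, LinearMap.comp_assoc,
    ← LinearMap.comp_assoc _ _ (LinearMap.adjoint (clebschGordan a b c)),
    adjoint_clebschGordan_comp_self h, LinearMap.id_comp, spinRep_comp, inv_mul_cancel, spinRep_one]

theorem adjoint_coupling_comp_of_ne (a b : ℕ) {c c' : ℕ} (h : c ≠ c') :
    LinearMap.adjoint (coupling a b c') ∘ₗ coupling a b c = 0 := by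
  rw [coupling, coupling, LinearMap.adjoint_comp, LinearMap.comp_assoc,
    ← LinearMap.comp_assoc _ _ (LinearMap.adjoint (clebschGordan a b c')),
    adjoint_clebschGordan_comp_of_ne a b h, LinearMap.zero_comp, LinearMap.comp_zero]

theorem sum_coupling_comp_adjoint (a b : ℕ) :
    ∑ c ∈ coupled a b, coupling a b c ∘ₗ LinearMap.adjoint (coupling a b c) = LinearMap.id := by
  simp_rw [coupling_comp_adjoint, sum_clebschGordan_comp_adjoint]

/-- An equivariant map from spin `c` to the tensor product of the spins `a` and `b` is a multiple
of the coupling map if `c` occurs, and zero otherwise. -/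
theorem exists_eq_smul_coupling {a b c : ℕ} {A : SpinSpace c →ₗ[ℂ] SpinSpace a ⊗[ℂ] SpinSpace b}
    (hA : ∀ u, A ∘ₗ spinRep c u = diagRep a b u ∘ₗ A) :
    if c ∈ coupled a b then ∃ z : ℂ, A = z • coupling a b c else A = 0 := by
  have hB : ∀ d u, (LinearMap.adjoint (coupling a b d) ∘ₗ A) ∘ₗ spinRep c u =
      spinRep d u ∘ₗ (LinearMap.adjoint (coupling a b d) ∘ₗ A) := by
    intro d u
    rw [LinearMap.comp_assoc, hA, ← LinearMap.comp_assoc, adjoint_coupling_comp_diagRep,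
      LinearMap.comp_assoc]
  -- Inserting the resolution of the identity reduces the claim to intertwiners between
  -- irreducibles, where only `d = c` survives.
  have hsum : A = ∑ d ∈ coupled a b, coupling a b d ∘ₗ
      (LinearMap.adjoint (coupling a b d) ∘ₗ A) := by
    simp_rw [← LinearMap.comp_assoc]
    rw [← linearMap_sum_comp, sum_coupling_comp_adjoint, LinearMap.id_comp]
  have h0 : ∀ d, d ≠ c → coupling a b d ∘ₗ (LinearMap.adjoint (coupling a b d) ∘ₗ A) = 0 := by
    intro d hd
    rw [spinRep_schur_ne hd.symm (hB d), LinearMap.comp_zero]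
  split_ifs with hc
  · obtain ⟨z, hz⟩ := spinRep_schur (hB c)
    refine ⟨z, ?_⟩
    rw [hsum, Finset.sum_eq_single c (fun d _ hd => h0 d hd) (fun h => absurd hc h), hz,
      LinearMap.comp_smul, LinearMap.comp_id]
  · rw [hsum]
    exact Finset.sum_eq_zero fun d hd => h0 d fun h => hc (h ▸ hd)

/-- Multiplicity one: every intertwiner is a multiple of the coupling map, so the supremum is a
single range. -/
theorem isotypicPart_diagRep {a b k : ℕ} (hk : k ∈ coupled a b) :
    isotypicPart (spinRep k) (diagRep a b) = LinearMap.range (coupling a b k) := by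
  refine le_antisymm (iSup_le fun T => ?_) ?_
  · have h := exists_eq_smul_coupling T.isIntertwining'
    rw [if_pos hk] at h
    obtain ⟨z, hz⟩ := h
    rw [hz]
    rintro _ ⟨x, rfl⟩
    exact ⟨z • x, by simp⟩
  · exact le_iSup (fun T : Representation.IntertwiningMap (spinRep k) (diagRep a b) =>
      LinearMap.range T.toLinearMap)
      ⟨coupling a b k, fun u => (diagRep_comp_coupling a b k u).symm⟩

theorem twoSpinProj_eq {a b k : ℕ} (hk : k ∈ coupled a b) :
    twoSpinProj a b k = coupling a b k ∘ₗ LinearMap.adjoint (coupling a b k) := by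
  rw [twoSpinProj, isotypicPart_diagRep hk,
    orthProj_range (adjoint_coupling_comp_self (mem_coupled.1 hk))]

/-! ### Schur's lemma for pairs of spins -/

theorem repr_rid_map_coord (a b : ℕ) (s : Fin (b + 1)) (r : Fin (a + 1))
    (t : SpinSpace a ⊗[ℂ] SpinSpace b) :
    (ladder a).repr (TensorProduct.rid ℂ _
      (TensorProduct.map LinearMap.id ((ladder b).toBasis.coord s) t)) r =
      ((ladder a).tensorProduct (ladder b)).repr t (r, s) := by
  induction t with
  | zero => simp
  | tmul x y => simp
  | add x y hx hy => simp only [map_add, PiLp.add_apply, hx, hy]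

theorem repr_lid_map_coord (a b : ℕ) (s : Fin (b + 1)) (r : Fin (a + 1))
    (t : SpinSpace a ⊗[ℂ] SpinSpace b) :
    (ladder b).repr (TensorProduct.lid ℂ _
      (TensorProduct.map ((ladder a).toBasis.coord r) LinearMap.id t)) s =
      ((ladder a).tensorProduct (ladder b)).repr t (r, s) := by
  induction t with
  | zero => simp
  | tmul x y => simp [mul_comm]
  | add x y hx hy => simp only [map_add, PiLp.add_apply, hx, hy]

section PairSchur

variable {a b a' b' : ℕ} {A : SpinSpace a ⊗[ℂ] SpinSpace b →ₗ[ℂ] SpinSpace a' ⊗[ℂ] SpinSpace b'}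

/-- With the second input vector and the second output coordinate frozen, an intertwiner for the
pair becomes one for the first `SU(2)` alone, because `(u, 1)` does not touch the second factor. -/
def partialRight (A : SpinSpace a ⊗[ℂ] SpinSpace b →ₗ[ℂ] SpinSpace a' ⊗[ℂ] SpinSpace b')
    (y : SpinSpace b) (s : Fin (b' + 1)) : SpinSpace a →ₗ[ℂ] SpinSpace a' :=
  (TensorProduct.rid ℂ _).toLinearMap ∘ₗ
    TensorProduct.map LinearMap.id ((ladder b').toBasis.coord s) ∘ₗ A ∘ₗ
      (TensorProduct.mk ℂ _ _).flip y

/-- The partial matrix element of `A` in the first tensor factor. -/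
def partialLeft (A : SpinSpace a ⊗[ℂ] SpinSpace b →ₗ[ℂ] SpinSpace a' ⊗[ℂ] SpinSpace b')
    (x : SpinSpace a) (r : Fin (a' + 1)) : SpinSpace b →ₗ[ℂ] SpinSpace b' :=
  (TensorProduct.lid ℂ _).toLinearMap ∘ₗ
    TensorProduct.map ((ladder a').toBasis.coord r) LinearMap.id ∘ₗ A ∘ₗ
      TensorProduct.mk ℂ _ _ x

theorem repr_partialRight (x : SpinSpace a) (y : SpinSpace b) (r : Fin (a' + 1))
    (s : Fin (b' + 1)) :
    (ladder a').repr (partialRight A y s x) r =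
      ((ladder a').tensorProduct (ladder b')).repr (A (x ⊗ₜ y)) (r, s) :=
  repr_rid_map_coord a' b' s r (A (x ⊗ₜ y))

theorem repr_partialLeft (x : SpinSpace a) (y : SpinSpace b) (r : Fin (a' + 1))
    (s : Fin (b' + 1)) :
    (ladder b').repr (partialLeft A x r y) s =
      ((ladder a').tensorProduct (ladder b')).repr (A (x ⊗ₜ y)) (r, s) :=
  repr_lid_map_coord a' b' s r (A (x ⊗ₜ y))

theorem partialRight_comp_spinRep (hA : ∀ g, A ∘ₗ pairRep a b g = pairRep a' b' g ∘ₗ A)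
    (y : SpinSpace b) (s : Fin (b' + 1)) (u : SU2) :
    partialRight A y s ∘ₗ spinRep a u = spinRep a' u ∘ₗ partialRight A y s := by
  ext1 x
  have h := LinearMap.congr_fun (hA (u, 1)) (x ⊗ₜ y)
  rw [LinearMap.comp_apply, LinearMap.comp_apply, pairRep_apply, pairRep_apply,
    TensorProduct.map_tmul, spinRep_one, spinRep_one, LinearMap.id_apply] at h
  have e : ∀ t : SpinSpace a' ⊗[ℂ] SpinSpace b',
      TensorProduct.rid ℂ _ (TensorProduct.map LinearMap.id ((ladder b').toBasis.coord s)
        (TensorProduct.map (spinRep a' u) LinearMap.id t)) =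
      spinRep a' u (TensorProduct.rid ℂ _
        (TensorProduct.map LinearMap.id ((ladder b').toBasis.coord s) t)) := by
    intro t
    induction t with
    | zero => simp
    | tmul x y => simp
    | add x y hx hy => simp only [map_add, hx, hy]
  change TensorProduct.rid ℂ _ (TensorProduct.map LinearMap.id ((ladder b').toBasis.coord s)
    (A (spinRep a u x ⊗ₜ y))) = _
  rw [h, e]
  rfl

theorem partialLeft_comp_spinRep (hA : ∀ g, A ∘ₗ pairRep a b g = pairRep a' b' g ∘ₗ A)
    (x : SpinSpace a) (r : Fin (a' + 1)) (v : SU2) :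
    partialLeft A x r ∘ₗ spinRep b v = spinRep b' v ∘ₗ partialLeft A x r := by
  ext1 y
  have h := LinearMap.congr_fun (hA (1, v)) (x ⊗ₜ y)
  rw [LinearMap.comp_apply, LinearMap.comp_apply, pairRep_apply, pairRep_apply,
    TensorProduct.map_tmul, spinRep_one, spinRep_one, LinearMap.id_apply] at h
  have e : ∀ t : SpinSpace a' ⊗[ℂ] SpinSpace b',
      TensorProduct.lid ℂ _ (TensorProduct.map ((ladder a').toBasis.coord r) LinearMap.id
        (TensorProduct.map LinearMap.id (spinRep b' v) t)) =
      spinRep b' v (TensorProduct.lid ℂ _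
        (TensorProduct.map ((ladder a').toBasis.coord r) LinearMap.id t)) := by
    intro t
    induction t with
    | zero => simp
    | tmul x y => simp
    | add x y hx hy => simp only [map_add, hx, hy]
  change TensorProduct.lid ℂ _ (TensorProduct.map ((ladder a').toBasis.coord r) LinearMap.id
    (A (x ⊗ₜ spinRep b v y))) = _
  rw [h, e]
  rfl

theorem pairRep_schur_ne (h : (a, b) ≠ (a', b'))
    (hA : ∀ g, A ∘ₗ pairRep a b g = pairRep a' b' g ∘ₗ A) : A = 0 := by
  refine TensorProduct.ext' fun x y => ?_
  apply ((ladder a').tensorProduct (ladder b')).repr.injective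
  ext ⟨r, s⟩
  by_cases ha : a = a'
  · have hb : b ≠ b' := fun hb => h (by rw [ha, hb])
    rw [← repr_partialLeft, spinRep_schur_ne hb (partialLeft_comp_spinRep hA x r)]
    simp
  · rw [← repr_partialRight, spinRep_schur_ne ha (partialRight_comp_spinRep hA y s)]
    simp

theorem pairRep_schur {A : SpinSpace a ⊗[ℂ] SpinSpace b →ₗ[ℂ] SpinSpace a ⊗[ℂ] SpinSpace b}
    (hA : ∀ g, A ∘ₗ pairRep a b g = pairRep a b g ∘ₗ A) : ∃ z : ℂ, A = z • LinearMap.id := by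
  choose zr hzr using fun y s => spinRep_schur (partialRight_comp_spinRep hA y s)
  choose zl hzl using fun x r => spinRep_schur (partialLeft_comp_spinRep hA x r)
  have hr : ∀ r s r' s', ((ladder a).tensorProduct (ladder b)).repr
      (A (ladder a r' ⊗ₜ ladder b s')) (r, s) = if r = r' then zr (ladder b s') s else 0 := by
    intro r s r' s'
    rw [← repr_partialRight, hzr]
    simp [PiLp.single_apply]
  have hl : ∀ r s r' s', ((ladder a).tensorProduct (ladder b)).repr
      (A (ladder a r' ⊗ₜ ladder b s')) (r, s) = if s = s' then zl (ladder a r') r else 0 := by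
    intro r s r' s'
    rw [← repr_partialLeft, hzl]
    simp [PiLp.single_apply]
  refine ⟨zr (ladder b 0) 0, ?_⟩
  refine ((ladder a).tensorProduct (ladder b)).toBasis.ext ?_
  rintro ⟨r', s'⟩
  apply ((ladder a).tensorProduct (ladder b)).repr.injective
  ext ⟨r, s⟩
  rw [OrthonormalBasis.coe_toBasis, OrthonormalBasis.tensorProduct_apply, hr]
  simp only [LinearMap.smul_apply, LinearMap.id_apply, map_smul, PiLp.smul_apply,
    OrthonormalBasis.tensorProduct_repr_tmul_apply, OrthonormalBasis.repr_self, PiLp.single_apply]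
  by_cases h1 : r = r'
  · subst h1
    by_cases h2 : s = s'
    · subst h2
      -- The entry at `(r, s)` depends only on `s` by the first partial argument and only on `r` by
      -- the second; passing through `(0, s)` to `(0, 0)` shows that it is constant.
      have e1 := hr 0 s 0 s
      have e2 := hl 0 s 0 s
      have e3 := hr 0 0 0 0
      have e4 := hl 0 0 0 0
      simp only [if_true] at e1 e2 e3 e4
      simp [← e1, e2, ← e3, e4]
    · have e1 := hr r s r s'
      have e2 := hl r s r s'
      rw [if_neg h2] at e2
      rw [← e1, e2]
      simp [h2]
  · simp [h1]

end PairSchur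

/-! ### Adjoint pairs of linear maps -/

section AdjointPair

variable {U V W : Type*} [NormedAddCommGroup U] [InnerProductSpace ℂ U] [FiniteDimensional ℂ U]
  [NormedAddCommGroup V] [InnerProductSpace ℂ V] [FiniteDimensional ℂ V]
  [NormedAddCommGroup W] [InnerProductSpace ℂ W] [FiniteDimensional ℂ W]

/-- `G'` is the adjoint of `G`. -/
def IsAdjointPair (G : V →ₗ[ℂ] W) (G' : W →ₗ[ℂ] V) : Prop := G' = LinearMap.adjoint G

theorem IsAdjointPair.comp {G : V →ₗ[ℂ] W} {G' : W →ₗ[ℂ] V} {F : U →ₗ[ℂ] V} {F' : V →ₗ[ℂ] U}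
    (hG : IsAdjointPair G G') (hF : IsAdjointPair F F') : IsAdjointPair (G ∘ₗ F) (F' ∘ₗ G') := by
  rw [IsAdjointPair, LinearMap.adjoint_comp, ← hG, ← hF]

theorem IsAdjointPair.symm {G : V →ₗ[ℂ] W} {G' : W →ₗ[ℂ] V} (hG : IsAdjointPair G G') :
    IsAdjointPair G' G := by
  rw [IsAdjointPair, hG, LinearMap.adjoint_adjoint]

theorem isAdjointPair_adjoint (G : V →ₗ[ℂ] W) : IsAdjointPair G (LinearMap.adjoint G) := rfl

theorem isAdjointPair_iff_repr {ι κ : Type*} [Fintype ι] [Fintype κ] (bV : OrthonormalBasis ι ℂ V)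
    (bW : OrthonormalBasis κ ℂ W) {G : V →ₗ[ℂ] W} {G' : W →ₗ[ℂ] V} :
    IsAdjointPair G G' ↔
      ∀ i j, bV.repr (G' (bW j)) i = starRingEnd ℂ (bW.repr (G (bV i)) j) := by
  rw [IsAdjointPair, LinearMap.eq_adjoint_iff_basis bW.toBasis bV.toBasis, forall_comm]
  refine forall_congr' fun i => forall_congr' fun j => ?_
  rw [OrthonormalBasis.coe_toBasis, OrthonormalBasis.coe_toBasis, OrthonormalBasis.repr_apply_apply,
    OrthonormalBasis.repr_apply_apply, inner_conj_symm, ← inner_conj_symm,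
    ← inner_conj_symm (bW j), (starRingEnd ℂ).injective.eq_iff]

theorem IsAdjointPair.repr_apply {ι κ : Type*} [Fintype ι] [Fintype κ]
    {G : V →ₗ[ℂ] W} {G' : W →ₗ[ℂ] V} (hG : IsAdjointPair G G') (bV : OrthonormalBasis ι ℂ V)
    (bW : OrthonormalBasis κ ℂ W) (y : W) (i : ι) :
    bV.repr (G' y) i = ∑ j, starRingEnd ℂ (bW.repr (G (bV i)) j) * bW.repr y j := by
  rw [OrthonormalBasis.repr_apply_apply, hG, LinearMap.adjoint_inner_right,
    ← bW.repr.inner_map_map, PiLp.inner_apply]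
  refine Finset.sum_congr rfl fun j _ => ?_
  rw [RCLike.inner_apply, mul_comm]

theorem IsAdjointPair.orthProj_range {G : V →ₗ[ℂ] W} {G' : W →ₗ[ℂ] V} (hG : IsAdjointPair G G')
    (h : G' ∘ₗ G = LinearMap.id) : orthProj (LinearMap.range G) = G ∘ₗ G' := by
  rw [hG] at h ⊢
  exact SpinRecoupling.orthProj_range h

end AdjointPair

/-! ### The four-fold space -/

/-- The interchange of the two inner factors of a four-fold tensor product. -/
def interchange (a a' b b' : ℕ) : FourSpace a a' b b' ≃ₗ[ℂ] FourSpace a b a' b' :=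
  TensorProduct.tensorTensorTensorComm ℂ _ _ _ _

theorem interchange_tmul (a a' b b' : ℕ) (x : SpinSpace a) (x' : SpinSpace a') (y : SpinSpace b)
    (y' : SpinSpace b') :
    interchange a a' b b' ((x ⊗ₜ x') ⊗ₜ (y ⊗ₜ y')) = (x ⊗ₜ y) ⊗ₜ (x' ⊗ₜ y') := rfl

theorem interchange_symm_tmul (a a' b b' : ℕ) (x : SpinSpace a) (x' : SpinSpace a')
    (y : SpinSpace b) (y' : SpinSpace b') :
    (interchange a a' b b').symm ((x ⊗ₜ y) ⊗ₜ (x' ⊗ₜ y')) = (x ⊗ₜ x') ⊗ₜ (y ⊗ₜ y') := rfl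

theorem repr_interchange (a a' b b' : ℕ) (p : Fin (a + 1)) (q : Fin (b + 1)) (p' : Fin (a' + 1))
    (q' : Fin (b' + 1)) (t : FourSpace a a' b b') :
    (((ladder a).tensorProduct (ladder b)).tensorProduct
      ((ladder a').tensorProduct (ladder b'))).repr (interchange a a' b b' t) ((p, q), (p', q')) =
    (((ladder a).tensorProduct (ladder a')).tensorProduct
      ((ladder b).tensorProduct (ladder b'))).repr t ((p, p'), (q, q')) := by
  induction t using TensorProduct.induction_on with
  | zero => simp only [map_zero, PiLp.zero_apply]
  | add x y hx hy => simp only [map_add, PiLp.add_apply, hx, hy]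
  | tmul s t =>
    induction s with
    | zero => simp only [TensorProduct.zero_tmul, map_zero, PiLp.zero_apply]
    | add x y hx hy => simp only [TensorProduct.add_tmul, map_add, PiLp.add_apply, hx, hy]
    | tmul x x' =>
      induction t with
      | zero => simp only [TensorProduct.tmul_zero, map_zero, PiLp.zero_apply]
      | add x y hx hy => simp only [TensorProduct.tmul_add, map_add, PiLp.add_apply, hx, hy]
      | tmul y y' =>
        rw [interchange_tmul]
        simp only [OrthonormalBasis.tensorProduct_repr_tmul_apply]
        ring

/-- The interchange permutes the product orthonormal bases, so it is unitary. -/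
theorem isAdjointPair_interchange (a a' b b' : ℕ) :
    IsAdjointPair (V := FourSpace a a' b b') (W := FourSpace a b a' b')
      (interchange a a' b b').toLinearMap (interchange a a' b b').symm.toLinearMap := by
  refine (isAdjointPair_iff_repr
    (((ladder a).tensorProduct (ladder a')).tensorProduct ((ladder b).tensorProduct (ladder b')))
    (((ladder a).tensorProduct (ladder b)).tensorProduct
      ((ladder a').tensorProduct (ladder b')))).2 ?_
  rintro ⟨⟨p, p'⟩, q, q'⟩ ⟨⟨r, s⟩, r', s'⟩
  have h : ∀ {n : ℕ} (i j : Fin n), (if i = j then (1 : ℂ) else 0) =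
      starRingEnd ℂ (if j = i then 1 else 0) := by
    intro n i j
    by_cases hij : i = j
    · simp [hij]
    · simp [hij, Ne.symm hij]
  simp only [OrthonormalBasis.tensorProduct_apply, LinearEquiv.coe_coe]
  rw [interchange_symm_tmul, interchange_tmul]
  simp only [OrthonormalBasis.tensorProduct_repr_tmul_apply, OrthonormalBasis.repr_self,
    PiLp.single_apply, map_mul]
  rw [← h, ← h, ← h, ← h]
  ring

theorem isAdjointPair_map {a b c d k l : ℕ} (f : SpinSpace k →ₗ[ℂ] SpinSpace a ⊗[ℂ] SpinSpace b)
    (g : SpinSpace l →ₗ[ℂ] SpinSpace c ⊗[ℂ] SpinSpace d) :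
    IsAdjointPair (V := SpinSpace k ⊗[ℂ] SpinSpace l) (W := FourSpace a b c d)
      (TensorProduct.map f g)
      (TensorProduct.map (LinearMap.adjoint f) (LinearMap.adjoint g)) := by
  refine (isAdjointPair_iff_repr ((ladder k).tensorProduct (ladder l))
    (((ladder a).tensorProduct (ladder b)).tensorProduct
      ((ladder c).tensorProduct (ladder d)))).2 ?_
  rintro ⟨r, s⟩ ⟨i, j⟩
  have hf := (isAdjointPair_iff_repr (ladder k) ((ladder a).tensorProduct (ladder b))).1
    (isAdjointPair_adjoint f) r i
  have hg := (isAdjointPair_iff_repr (ladder l) ((ladder c).tensorProduct (ladder d))).1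
    (isAdjointPair_adjoint g) s j
  rw [OrthonormalBasis.tensorProduct_apply ((ladder a).tensorProduct (ladder b)),
    OrthonormalBasis.tensorProduct_apply (ladder k), TensorProduct.map_tmul, TensorProduct.map_tmul,
    OrthonormalBasis.tensorProduct_repr_tmul_apply,
    OrthonormalBasis.tensorProduct_repr_tmul_apply, hf, hg, map_mul]

theorem fourRep_apply (a b a' b' : ℕ) (u v : SU2) :
    fourRep a b a' b' (u, v) =
      TensorProduct.map (pairRep a b (u, v)) (pairRep a' b' (u, v)) := rfl

theorem fourRep_interchange (a b a' b' : ℕ) (u v : SU2) :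
    fourRep a b a' b' (u, v) ∘ₗ (interchange a a' b b').toLinearMap =
      (interchange a a' b b').toLinearMap ∘ₗ
        TensorProduct.map (diagRep a a' u) (diagRep b b' v) := by
  refine TensorProduct.ext_fourfold' fun x x' y y' => ?_
  rfl

/-- The embedding of `H_{J₁} ⊗ H_{J₂}` into the four-fold space. -/
def embed (a b a' b' J₁ J₂ : ℕ) : SpinSpace J₁ ⊗[ℂ] SpinSpace J₂ →ₗ[ℂ] FourSpace a b a' b' :=
  (interchange a a' b b').toLinearMap ∘ₗ
    TensorProduct.map (coupling a a' J₁) (coupling b b' J₂)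

def embedAdj (a b a' b' J₁ J₂ : ℕ) : FourSpace a b a' b' →ₗ[ℂ] SpinSpace J₁ ⊗[ℂ] SpinSpace J₂ :=
  TensorProduct.map (LinearMap.adjoint (coupling a a' J₁)) (LinearMap.adjoint (coupling b b' J₂)) ∘ₗ
    (interchange a a' b b').symm.toLinearMap

theorem isAdjointPair_embed (a b a' b' J₁ J₂ : ℕ) :
    IsAdjointPair (V := SpinSpace J₁ ⊗[ℂ] SpinSpace J₂) (W := FourSpace a b a' b')
      (embed a b a' b' J₁ J₂) (embedAdj a b a' b' J₁ J₂) :=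
  IsAdjointPair.comp (isAdjointPair_interchange a a' b b') (isAdjointPair_map _ _)

theorem fourRep_comp_embed (a b a' b' J₁ J₂ : ℕ) (g : SU2 × SU2) :
    fourRep a b a' b' g ∘ₗ embed a b a' b' J₁ J₂ = embed a b a' b' J₁ J₂ ∘ₗ pairRep J₁ J₂ g := by
  obtain ⟨u, v⟩ := g
  rw [embed, ← LinearMap.comp_assoc, fourRep_interchange, LinearMap.comp_assoc,
    LinearMap.comp_assoc, ← TensorProduct.map_comp, diagRep_comp_coupling, diagRep_comp_coupling,
    TensorProduct.map_comp, pairRep_apply]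

theorem interchange_symm_comp (a a' b b' : ℕ) :
    (interchange a a' b b').symm.toLinearMap ∘ₗ (interchange a a' b b').toLinearMap =
      LinearMap.id := by
  refine LinearMap.ext fun x => ?_
  exact (interchange a a' b b').symm_apply_apply x

theorem interchange_comp_symm (a a' b b' : ℕ) :
    (interchange a a' b b').toLinearMap ∘ₗ (interchange a a' b b').symm.toLinearMap =
      LinearMap.id := by
  refine LinearMap.ext fun x => ?_
  exact (interchange a a' b b').apply_symm_apply x

theorem interchange_symm_fourRep (a b a' b' : ℕ) (u v : SU2) :
    (interchange a a' b b').symm.toLinearMap ∘ₗ fourRep a b a' b' (u, v) =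
      TensorProduct.map (diagRep a a' u) (diagRep b b' v) ∘ₗ
        (interchange a a' b b').symm.toLinearMap :=
  TensorProduct.ext_fourfold' fun _ _ _ _ => rfl

theorem embedAdj_comp_fourRep (a b a' b' J₁ J₂ : ℕ) (g : SU2 × SU2) :
    embedAdj a b a' b' J₁ J₂ ∘ₗ fourRep a b a' b' g =
      pairRep J₁ J₂ g ∘ₗ embedAdj a b a' b' J₁ J₂ := by
  obtain ⟨u, v⟩ := g
  rw [embedAdj, LinearMap.comp_assoc, interchange_symm_fourRep, ← LinearMap.comp_assoc,
    ← TensorProduct.map_comp, adjoint_coupling_comp_diagRep, adjoint_coupling_comp_diagRep,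
    TensorProduct.map_comp, pairRep_apply, LinearMap.comp_assoc]

theorem embedAdj_comp_self {a b a' b' J₁ J₂ : ℕ} (h₁ : J₁ ∈ coupled a a')
    (h₂ : J₂ ∈ coupled b b') :
    embedAdj a b a' b' J₁ J₂ ∘ₗ embed a b a' b' J₁ J₂ = LinearMap.id := by
  rw [embed, embedAdj, LinearMap.comp_assoc, ← LinearMap.comp_assoc _ _
    (interchange a a' b b').symm.toLinearMap, interchange_symm_comp, LinearMap.id_comp,
    ← TensorProduct.map_comp, adjoint_coupling_comp_self (mem_coupled.1 h₁),
    adjoint_coupling_comp_self (mem_coupled.1 h₂), TensorProduct.map_id]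

theorem map_sum_sum {ι κ U U' V V' : Type*} [AddCommGroup U] [Module ℂ U] [AddCommGroup U']
    [Module ℂ U'] [AddCommGroup V] [Module ℂ V] [AddCommGroup V'] [Module ℂ V'] (s : Finset ι)
    (t : Finset κ) (f : ι → U →ₗ[ℂ] U') (g : κ → V →ₗ[ℂ] V') :
    TensorProduct.map (∑ i ∈ s, f i) (∑ j ∈ t, g j) =
      ∑ i ∈ s, ∑ j ∈ t, TensorProduct.map (f i) (g j) := by
  refine TensorProduct.ext' fun x y => ?_
  simp only [TensorProduct.map_tmul, LinearMap.sum_apply, TensorProduct.sum_tmul,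
    TensorProduct.tmul_sum]
  exact Finset.sum_comm

theorem sum_embed_comp_embedAdj (a b a' b' : ℕ) :
    ∑ J₁ ∈ coupled a a', ∑ J₂ ∈ coupled b b',
      embed a b a' b' J₁ J₂ ∘ₗ embedAdj a b a' b' J₁ J₂ = LinearMap.id := by
  have h : ∀ J₁ J₂, embed a b a' b' J₁ J₂ ∘ₗ embedAdj a b a' b' J₁ J₂ =
      (interchange a a' b b').toLinearMap ∘ₗ
        TensorProduct.map (coupling a a' J₁ ∘ₗ LinearMap.adjoint (coupling a a' J₁))
          (coupling b b' J₂ ∘ₗ LinearMap.adjoint (coupling b b' J₂)) ∘ₗ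
        (interchange a a' b b').symm.toLinearMap := by
    intro J₁ J₂
    rw [embed, embedAdj, TensorProduct.map_comp]
    simp only [LinearMap.comp_assoc]
  simp_rw [h, ← linearMap_comp_sum, ← linearMap_sum_comp]
  rw [← map_sum_sum, sum_coupling_comp_adjoint, sum_coupling_comp_adjoint, TensorProduct.map_id,
    LinearMap.id_comp, interchange_comp_symm]

/-- Multiplicity one for `SU(2) × SU(2)`: in the resolution of the identity by the copies, Schur's
lemma for pairs kills every block except `(J₁, J₂)`. -/
theorem exists_eq_smul_embed {a b a' b' J₁ J₂ : ℕ} (h₁ : J₁ ∈ coupled a a')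
    (h₂ : J₂ ∈ coupled b b') {A : SpinSpace J₁ ⊗[ℂ] SpinSpace J₂ →ₗ[ℂ] FourSpace a b a' b'}
    (hA : ∀ g, A ∘ₗ pairRep J₁ J₂ g = fourRep a b a' b' g ∘ₗ A) :
    ∃ z : ℂ, A = z • embed a b a' b' J₁ J₂ := by
  have hB : ∀ I₁ I₂ g, (embedAdj a b a' b' I₁ I₂ ∘ₗ A) ∘ₗ pairRep J₁ J₂ g =
      pairRep I₁ I₂ g ∘ₗ (embedAdj a b a' b' I₁ I₂ ∘ₗ A) := by
    intro I₁ I₂ g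
    rw [LinearMap.comp_assoc, hA, ← LinearMap.comp_assoc, embedAdj_comp_fourRep,
      LinearMap.comp_assoc]
  have hsum : A = ∑ I₁ ∈ coupled a a', ∑ I₂ ∈ coupled b b', embed a b a' b' I₁ I₂ ∘ₗ
      (embedAdj a b a' b' I₁ I₂ ∘ₗ A) := by
    simp_rw [← LinearMap.comp_assoc, ← linearMap_sum_comp]
    rw [sum_embed_comp_embedAdj, LinearMap.id_comp]
  have h0 : ∀ I₁ I₂, (J₁, J₂) ≠ (I₁, I₂) →
      embed a b a' b' I₁ I₂ ∘ₗ (embedAdj a b a' b' I₁ I₂ ∘ₗ A) = 0 := by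
    intro I₁ I₂ hne
    rw [pairRep_schur_ne hne (hB I₁ I₂), LinearMap.comp_zero]
  obtain ⟨z, hz⟩ := pairRep_schur (hB J₁ J₂)
  refine ⟨z, ?_⟩
  rw [hsum, Finset.sum_eq_single J₁, Finset.sum_eq_single J₂, hz, LinearMap.comp_smul,
    LinearMap.comp_id]
  · exact fun I₂ _ hne => h0 J₁ I₂ fun e => hne (Prod.ext_iff.1 e).2.symm
  · exact fun h => absurd h₂ h
  · exact fun I₁ _ hne => Finset.sum_eq_zero fun I₂ _ =>
      h0 I₁ I₂ fun e => hne (Prod.ext_iff.1 e).1.symm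
  · exact fun h => absurd h₁ h

/-- The case of the whole space serves the copy projectors, and the range of `P^K` serves the grand
projectors. -/
theorem iSup_map_intertwiningMap {a b a' b' J₁ J₂ : ℕ} (h₁ : J₁ ∈ coupled a a')
    (h₂ : J₂ ∈ coupled b b') (U : Submodule ℂ (SpinSpace J₁ ⊗[ℂ] SpinSpace J₂)) :
    ⨆ T : Representation.IntertwiningMap (pairRep J₁ J₂) (fourRep a b a' b'),
      U.map T.toLinearMap = U.map (embed a b a' b' J₁ J₂) := by
  refine le_antisymm (iSup_le fun T => ?_) ?_
  · obtain ⟨z, hz⟩ := exists_eq_smul_embed h₁ h₂ T.isIntertwining'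
    rw [hz]
    rintro _ ⟨x, hx, rfl⟩
    exact ⟨z • x, U.smul_mem z hx, by simp⟩
  · exact le_iSup (fun T : Representation.IntertwiningMap (pairRep J₁ J₂) (fourRep a b a' b') =>
      U.map T.toLinearMap)
      ⟨embed a b a' b' J₁ J₂, fun g => (fourRep_comp_embed a b a' b' J₁ J₂ g).symm⟩

theorem copyProj_eq {a b a' b' J₁ J₂ : ℕ} (h₁ : J₁ ∈ coupled a a') (h₂ : J₂ ∈ coupled b b') :
    copyProj a b a' b' J₁ J₂ = embed a b a' b' J₁ J₂ ∘ₗ embedAdj a b a' b' J₁ J₂ := by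
  have h : isotypicPart (pairRep J₁ J₂) (fourRep a b a' b') =
      LinearMap.range (embed a b a' b' J₁ J₂) := by
    rw [isotypicPart, LinearMap.range_eq_map, ← iSup_map_intertwiningMap h₁ h₂]
    simp only [LinearMap.range_eq_map]
  rw [copyProj, h]
  exact (isAdjointPair_embed a b a' b' J₁ J₂).orthProj_range (embedAdj_comp_self h₁ h₂)

theorem grandProj_eq {a b a' b' J₁ J₂ K : ℕ} (h₁ : J₁ ∈ coupled a a') (h₂ : J₂ ∈ coupled b b')
    (hK : K ∈ coupled J₁ J₂) :
    grandProj a b a' b' J₁ J₂ K =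
      embed a b a' b' J₁ J₂ ∘ₗ twoSpinProj J₁ J₂ K ∘ₗ embedAdj a b a' b' J₁ J₂ := by
  have hr : (LinearMap.range (twoSpinProj J₁ J₂ K)).map (embed a b a' b' J₁ J₂) =
      LinearMap.range (embed a b a' b' J₁ J₂ ∘ₗ coupling J₁ J₂ K) := by
    rw [twoSpinProj_eq hK, LinearMap.range_self_comp_adjoint, LinearMap.range_comp]
  have hiso : (LinearMap.adjoint (coupling J₁ J₂ K) ∘ₗ embedAdj a b a' b' J₁ J₂) ∘ₗ
      (embed a b a' b' J₁ J₂ ∘ₗ coupling J₁ J₂ K) = LinearMap.id := by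
    rw [LinearMap.comp_assoc, ← LinearMap.comp_assoc _ _ (embedAdj a b a' b' J₁ J₂),
      embedAdj_comp_self h₁ h₂, LinearMap.id_comp, adjoint_coupling_comp_self (mem_coupled.1 hK)]
  rw [grandProj, iSup_map_intertwiningMap h₁ h₂, hr, twoSpinProj_eq hK]
  refine (((isAdjointPair_embed a b a' b' J₁ J₂).comp
    (isAdjointPair_adjoint (coupling J₁ J₂ K))).orthProj_range hiso).trans ?_
  simp only [LinearMap.comp_assoc]

/-! ### Recoupling coefficients -/

theorem IsAdjointPair.unique {V W : Type*} [NormedAddCommGroup V] [InnerProductSpace ℂ V]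
    [FiniteDimensional ℂ V] [NormedAddCommGroup W] [InnerProductSpace ℂ W] [FiniteDimensional ℂ W]
    {G : V →ₗ[ℂ] W} {A B : W →ₗ[ℂ] V} (hA : IsAdjointPair G A) (hB : IsAdjointPair G B) : A = B :=
  Eq.trans hA (Eq.symm hB)

theorem repr_map_clebschGordan (a b c d k l K : ℕ) (p : Fin (a + 1)) (q : Fin (b + 1))
    (p' : Fin (c + 1)) (q' : Fin (d + 1)) (M : Fin (K + 1)) :
    (((ladder a).tensorProduct (ladder b)).tensorProduct
      ((ladder c).tensorProduct (ladder d))).repr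
      (TensorProduct.map (clebschGordan a b k) (clebschGordan c d l)
        (clebschGordan k l K (ladder K M))) ((p, q), (p', q')) =
      ((√(K + 1 : ℝ) * (√(k + 1 : ℝ) * √(l + 1 : ℝ)) * ∑ m, ∑ m', threeJ k l K m m' M *
        (threeJ a b k p q m * threeJ c d l p' q' m') : ℝ) : ℂ) := by
  rw [clebschGordan_ladder k l K]
  simp only [map_smul, map_sum, TensorProduct.map_tmul, PiLp.smul_apply, WithLp.ofLp_sum,
    Finset.sum_apply, OrthonormalBasis.tensorProduct_repr_tmul_apply, repr_clebschGordan_ladder,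
    smul_eq_mul, Finset.mul_sum]
  push_cast
  refine Finset.sum_congr rfl fun _ _ => Finset.sum_congr rfl fun _ _ => ?_
  ring

theorem twist_conjElement : twist conjElement = conjElement := by simp [twist]

/-- `conjElement` is fixed by `twist`, so the corrections in the two inner couplings slide through
the outer one and merge with its own. The same group element appears for both coupling orders, so it
cancels in the trace. -/
theorem map_coupling_comp_coupling (a b c d k l K : ℕ) :
    TensorProduct.map (coupling a b k) (coupling c d l) ∘ₗ coupling k l K =
      (TensorProduct.map (clebschGordan a b k) (clebschGordan c d l) ∘ₗ clebschGordan k l K) ∘ₗ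
        spinRep K (conjElement * conjElement) := by
  have h := diagRep_comp_clebschGordan k l K conjElement
  rw [twist_conjElement, diagRep_apply] at h
  rw [coupling, coupling, coupling, TensorProduct.map_comp, LinearMap.comp_assoc,
    ← LinearMap.comp_assoc (spinRep K conjElement), h, LinearMap.comp_assoc, spinRep_comp,
    LinearMap.comp_assoc]

theorem isAdjointPair_map_comp (a b c d k l K : ℕ)
    (f : SpinSpace k →ₗ[ℂ] SpinSpace a ⊗[ℂ] SpinSpace b)
    (g : SpinSpace l →ₗ[ℂ] SpinSpace c ⊗[ℂ] SpinSpace d)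
    (h : SpinSpace K →ₗ[ℂ] SpinSpace k ⊗[ℂ] SpinSpace l) :
    IsAdjointPair (V := SpinSpace K) (W := FourSpace a b c d) (TensorProduct.map f g ∘ₗ h)
      (LinearMap.adjoint h ∘ₗ
        TensorProduct.map (LinearMap.adjoint f) (LinearMap.adjoint g)) :=
  (isAdjointPair_map f g).comp (isAdjointPair_adjoint h)

theorem adjoint_coupling_comp_map (a b c d k l K : ℕ) :
    LinearMap.adjoint (coupling k l K) ∘ₗ TensorProduct.map (LinearMap.adjoint (coupling a b k))
        (LinearMap.adjoint (coupling c d l)) =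
      spinRep K (conjElement * conjElement)⁻¹ ∘ₗ (LinearMap.adjoint (clebschGordan k l K) ∘ₗ
        TensorProduct.map (LinearMap.adjoint (clebschGordan a b k))
          (LinearMap.adjoint (clebschGordan c d l))) := by
  have h1 := isAdjointPair_map_comp a b c d k l K (coupling a b k) (coupling c d l)
    (coupling k l K)
  have h2 := (isAdjointPair_map_comp a b c d k l K (clebschGordan a b k) (clebschGordan c d l)
    (clebschGordan k l K)).comp (isAdjointPair_adjoint (spinRep K (conjElement * conjElement)))
  rw [map_coupling_comp_coupling] at h1
  rw [adjoint_spinRep] at h2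
  exact h1.unique h2

/-- The recoupling operator from `H_{J₁} ⊗ H_{J₂}` to `H_k ⊗ H_{k'}`. -/
def recoupling (j₁ j₂ k j₁' j₂' k' J₁ J₂ : ℕ) :
    SpinSpace J₁ ⊗[ℂ] SpinSpace J₂ →ₗ[ℂ] SpinSpace k ⊗[ℂ] SpinSpace k' :=
  TensorProduct.map (LinearMap.adjoint (coupling j₁ j₂ k)) (LinearMap.adjoint (coupling j₁' j₂' k'))
    ∘ₗ embed j₁ j₂ j₁' j₂' J₁ J₂

def recouplingAdj (j₁ j₂ k j₁' j₂' k' J₁ J₂ : ℕ) :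
    SpinSpace k ⊗[ℂ] SpinSpace k' →ₗ[ℂ] SpinSpace J₁ ⊗[ℂ] SpinSpace J₂ :=
  embedAdj j₁ j₂ j₁' j₂' J₁ J₂ ∘ₗ TensorProduct.map (coupling j₁ j₂ k) (coupling j₁' j₂' k')

theorem isAdjointPair_recoupling (j₁ j₂ k j₁' j₂' k' J₁ J₂ : ℕ) :
    IsAdjointPair (recoupling j₁ j₂ k j₁' j₂' k' J₁ J₂)
      (recouplingAdj j₁ j₂ k j₁' j₂' k' J₁ J₂) :=
  (isAdjointPair_map (coupling j₁ j₂ k) (coupling j₁' j₂' k')).symm.comp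
    (isAdjointPair_embed j₁ j₂ j₁' j₂' J₁ J₂)

theorem recoupling_comp_diagRep (j₁ j₂ k j₁' j₂' k' J₁ J₂ : ℕ) (u : SU2) :
    recoupling j₁ j₂ k j₁' j₂' k' J₁ J₂ ∘ₗ diagRep J₁ J₂ u =
      diagRep k k' u ∘ₗ recoupling j₁ j₂ k j₁' j₂' k' J₁ J₂ := by
  -- Equivariance is restricted to `(u, u)`: coupling `j₁` with `j₂` is compatible only with the
  -- diagonal subgroup.
  have h1 : embed j₁ j₂ j₁' j₂' J₁ J₂ ∘ₗ diagRep J₁ J₂ u =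
      TensorProduct.map (diagRep j₁ j₂ u) (diagRep j₁' j₂' u) ∘ₗ embed j₁ j₂ j₁' j₂' J₁ J₂ :=
    (fourRep_comp_embed j₁ j₂ j₁' j₂' J₁ J₂ (u, u)).symm
  rw [recoupling, LinearMap.comp_assoc, h1, ← LinearMap.comp_assoc, ← TensorProduct.map_comp,
    adjoint_coupling_comp_diagRep, adjoint_coupling_comp_diagRep, TensorProduct.map_comp,
    LinearMap.comp_assoc, diagRep_apply]

theorem sum_reorder {ι₁ ι₂ ι₃ ι₄ ι₅ ι₆ ι₇ ι₈ ι₉ : Type*} [Fintype ι₁] [Fintype ι₂] [Fintype ι₃]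
    [Fintype ι₄] [Fintype ι₅] [Fintype ι₆] [Fintype ι₇] [Fintype ι₈] [Fintype ι₉]
    (f : ι₁ → ι₂ → ι₃ → ι₄ → ι₅ → ι₆ → ι₇ → ι₈ → ι₉ → ℝ) :
    ∑ M, ∑ p, ∑ q, ∑ p', ∑ q', ∑ m, ∑ m', ∑ r, ∑ s, f p q m p' q' m' r s M =
      ∑ p, ∑ q, ∑ m, ∑ p', ∑ q', ∑ m', ∑ r, ∑ s, ∑ M, f p q m p' q' m' r s M := by
  have h := Fintype.sum_equiv
    (⟨fun x => (x.2.1, x.2.2.1, x.2.2.2.2.2.1, x.2.2.2.1, x.2.2.2.2.1, x.2.2.2.2.2.2.1,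
        x.2.2.2.2.2.2.2.1, x.2.2.2.2.2.2.2.2, x.1),
      fun x => (x.2.2.2.2.2.2.2.2, x.1, x.2.1, x.2.2.2.1, x.2.2.2.2.1, x.2.2.1, x.2.2.2.2.2.1,
        x.2.2.2.2.2.2.1, x.2.2.2.2.2.2.2.1), fun _ => rfl, fun _ => rfl⟩ :
      ι₉ × ι₁ × ι₂ × ι₄ × ι₅ × ι₃ × ι₆ × ι₇ × ι₈ ≃ ι₁ × ι₂ × ι₃ × ι₄ × ι₅ × ι₆ × ι₇ × ι₈ × ι₉)
    (fun x => f x.2.1 x.2.2.1 x.2.2.2.2.2.1 x.2.2.2.1 x.2.2.2.2.1 x.2.2.2.2.2.2.1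
        x.2.2.2.2.2.2.2.1 x.2.2.2.2.2.2.2.2 x.1)
    (fun x => f x.1 x.2.1 x.2.2.1 x.2.2.2.1 x.2.2.2.2.1 x.2.2.2.2.2.1 x.2.2.2.2.2.2.1
        x.2.2.2.2.2.2.2.1 x.2.2.2.2.2.2.2.2) fun _ => rfl
  simpa only [Fintype.sum_prod_type] using h

/-- For fixed `M`, the two factors are, up to normalisation, the ladder coefficients of a spin-`K`
vector coupled through `(k, k')` and through `(J₁, J₂)`; the symbol is their inner product, summed
over `M`. -/
theorem nineJ_eq_sum (j₁ j₂ k j₁' j₂' k' J₁ J₂ K : ℕ) :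
    nineJ j₁ j₂ k j₁' j₂' k' J₁ J₂ K =
      ∑ M, ∑ p, ∑ q, ∑ p', ∑ q',
        (∑ m, ∑ m', threeJ k k' K m m' M * (threeJ j₁ j₂ k p q m * threeJ j₁' j₂' k' p' q' m')) *
          ∑ r, ∑ s, threeJ J₁ J₂ K r s M * (threeJ j₁ j₁' J₁ p p' r * threeJ j₂ j₂' J₂ q q' s) := by
  rw [nineJ, ← sum_reorder]
  refine Finset.sum_congr rfl fun M _ => Finset.sum_congr rfl fun p _ =>
    Finset.sum_congr rfl fun q _ => Finset.sum_congr rfl fun p' _ =>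
    Finset.sum_congr rfl fun q' _ => ?_
  rw [Finset.sum_mul]
  refine Finset.sum_congr rfl fun m _ => ?_
  rw [Finset.sum_mul]
  refine Finset.sum_congr rfl fun m' _ => ?_
  rw [Finset.mul_sum]
  refine Finset.sum_congr rfl fun r _ => ?_
  rw [Finset.mul_sum]
  refine Finset.sum_congr rfl fun s _ => ?_
  ring

theorem ofReal_mul_sum {ι₁ ι₂ ι₃ ι₄ : Type*} [Fintype ι₁] [Fintype ι₂] [Fintype ι₃] [Fintype ι₄]
    (z : ℝ) (f : ι₁ → ι₂ → ι₃ → ι₄ → ℝ) :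
    ((z * ∑ p, ∑ q, ∑ p', ∑ q', f p q p' q' : ℝ) : ℂ) =
      ∑ p, ∑ q, ∑ p', ∑ q', ((z * f p q p' q' : ℝ) : ℂ) := by
  simp only [Finset.mul_sum, Complex.ofReal_sum]

/-- The trace turns the Schur scalar into a sum over all magnetic numbers, namely the `9j` symbol.
The two outer couplings each carry `√(K + 1)`, whence the factor `K + 1`, which is the dimension of
spin `K`. -/
theorem trace_recoupling (j₁ j₂ k j₁' j₂' k' J₁ J₂ K : ℕ) :
    LinearMap.trace ℂ _ (LinearMap.adjoint (coupling k k' K) ∘ₗ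
      recoupling j₁ j₂ k j₁' j₂' k' J₁ J₂ ∘ₗ coupling J₁ J₂ K) =
      (((K + 1) * (√(k + 1 : ℝ) * √(k' + 1 : ℝ) * √(J₁ + 1 : ℝ) * √(J₂ + 1 : ℝ) *
        nineJ j₁ j₂ k j₁' j₂' k' J₁ J₂ K) : ℝ) : ℂ) := by
  set B₁ := LinearMap.adjoint (clebschGordan k k' K) ∘ₗ TensorProduct.map
    (LinearMap.adjoint (clebschGordan j₁ j₂ k)) (LinearMap.adjoint (clebschGordan j₁' j₂' k'))
    with hB₁
  set B₂ := (interchange j₁ j₁' j₂ j₂').toLinearMap ∘ₗ TensorProduct.map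
    (clebschGordan j₁ j₁' J₁) (clebschGordan j₂ j₂' J₂) ∘ₗ clebschGordan J₁ J₂ K with hB₂
  have h1 : LinearMap.adjoint (coupling k k' K) ∘ₗ
      recoupling j₁ j₂ k j₁' j₂' k' J₁ J₂ ∘ₗ coupling J₁ J₂ K =
      spinRep K (conjElement * conjElement)⁻¹ ∘ₗ ((B₁ ∘ₗ B₂) ∘ₗ
        spinRep K (conjElement * conjElement)) := by
    calc _ = (LinearMap.adjoint (coupling k k' K) ∘ₗ TensorProduct.map
          (LinearMap.adjoint (coupling j₁ j₂ k)) (LinearMap.adjoint (coupling j₁' j₂' k'))) ∘ₗ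
          (interchange j₁ j₁' j₂ j₂').toLinearMap ∘ₗ
          (TensorProduct.map (coupling j₁ j₁' J₁) (coupling j₂ j₂' J₂) ∘ₗ coupling J₁ J₂ K) := by
          rw [recoupling, embed]
          simp only [LinearMap.comp_assoc]
      _ = _ := by
          rw [adjoint_coupling_comp_map, map_coupling_comp_coupling]
          simp only [LinearMap.comp_assoc, hB₁, hB₂]
  rw [h1, LinearMap.trace_comp_comm', LinearMap.comp_assoc, spinRep_comp, mul_inv_cancel,
    spinRep_one, LinearMap.comp_id, LinearMap.trace_eq_sum_inner _ (ladder K), nineJ_eq_sum]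
  have h2 : ∀ M, inner ℂ (ladder K M) ((B₁ ∘ₗ B₂) (ladder K M)) =
      (((K + 1) * (√(k + 1 : ℝ) * √(k' + 1 : ℝ) * √(J₁ + 1 : ℝ) * √(J₂ + 1 : ℝ)) *
        ∑ p, ∑ q, ∑ p', ∑ q',
        (∑ m, ∑ m', threeJ k k' K m m' M * (threeJ j₁ j₂ k p q m * threeJ j₁' j₂' k' p' q' m')) *
          ∑ r, ∑ s, threeJ J₁ J₂ K r s M * (threeJ j₁ j₁' J₁ p p' r * threeJ j₂ j₂' J₂ q q' s) :
          ℝ) : ℂ) := by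
    intro M
    rw [← OrthonormalBasis.repr_apply_apply, LinearMap.comp_apply,
      (isAdjointPair_map_comp j₁ j₂ j₁' j₂' k k' K (clebschGordan j₁ j₂ k)
        (clebschGordan j₁' j₂' k') (clebschGordan k k' K)).repr_apply (ladder K)
        (((ladder j₁).tensorProduct (ladder j₂)).tensorProduct
          ((ladder j₁').tensorProduct (ladder j₂')))]
    rw [ofReal_mul_sum]
    simp only [Fintype.sum_prod_type]
    refine Finset.sum_congr rfl fun p _ => Finset.sum_congr rfl fun q _ =>
      Finset.sum_congr rfl fun p' _ => Finset.sum_congr rfl fun q' _ => ?_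
    rw [hB₂, LinearMap.comp_apply, LinearMap.comp_apply, LinearMap.comp_apply,
      LinearEquiv.coe_coe, repr_interchange, repr_map_clebschGordan, repr_map_clebschGordan,
      Complex.conj_ofReal, ← Complex.ofReal_mul]
    have hK : √(K + 1 : ℝ) * √(K + 1 : ℝ) = K + 1 := Real.mul_self_sqrt (by positivity)
    congr 1
    generalize √(K + 1 : ℝ) = t at hK ⊢
    rw [← hK]
    ring
  simp_rw [h2, ← Complex.ofReal_sum, ← Finset.mul_sum]
  congr 1
  ring

theorem recoupling_comp_coupling (j₁ j₂ k j₁' j₂' k' J₁ J₂ K : ℕ) :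
    recoupling j₁ j₂ k j₁' j₂' k' J₁ J₂ ∘ₗ coupling J₁ J₂ K =
      ((√(k + 1 : ℝ) * √(k' + 1 : ℝ) * √(J₁ + 1 : ℝ) * √(J₂ + 1 : ℝ) *
        nineJ j₁ j₂ k j₁' j₂' k' J₁ J₂ K : ℝ) : ℂ) • coupling k k' K := by
  have hA : ∀ u, (recoupling j₁ j₂ k j₁' j₂' k' J₁ J₂ ∘ₗ coupling J₁ J₂ K) ∘ₗ spinRep K u =
      diagRep k k' u ∘ₗ (recoupling j₁ j₂ k j₁' j₂' k' J₁ J₂ ∘ₗ coupling J₁ J₂ K) := by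
    intro u
    rw [LinearMap.comp_assoc, ← diagRep_comp_coupling, ← LinearMap.comp_assoc,
      recoupling_comp_diagRep, LinearMap.comp_assoc]
  have h := exists_eq_smul_coupling hA
  have ht := trace_recoupling j₁ j₂ k j₁' j₂' k' J₁ J₂ K
  have hK : (K + 1 : ℂ) ≠ 0 := by exact_mod_cast K.succ_ne_zero
  split_ifs at h with hc
  · obtain ⟨z, hz⟩ := h
    rw [hz, LinearMap.comp_smul, adjoint_coupling_comp_self (mem_coupled.1 hc), map_smul,
      LinearMap.trace_id] at ht
    rw [hz]
    congr 1
    apply mul_left_cancel₀ hK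
    rw [Complex.ofReal_mul (K + 1 : ℝ)] at ht
    simpa [mul_comm z] using ht
  -- If `K` does not occur in `k ⊗ k'`, the map vanishes, and the trace formula itself shows that
  -- the coefficient is zero.
  · rw [h, LinearMap.comp_zero, map_zero] at ht
    have h0 : (0 : ℝ) = _ := Complex.ofReal_injective ht
    have hK' : (K + 1 : ℝ) ≠ 0 := by positivity
    rw [h, (mul_eq_zero.1 h0.symm).resolve_left hK', Complex.ofReal_zero, zero_smul]

theorem nineJ_eq_zero (j₁ j₂ k j₁' j₂' k' J₁ J₂ K : ℕ) (h : ¬ Triangle k k' K) :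
    nineJ j₁ j₂ k j₁' j₂' k' J₁ J₂ K = 0 := by
  simp [nineJ, threeJ_eq_zero h]

/-- The coefficient is real, so `R†` carries the same scalar as `R` and the `K`-block is its square:
this is where the `9j` symbol gets squared and the roots of the dimensions disappear. -/
theorem adjoint_coupling_comp_recoupling (j₁ j₂ k j₁' j₂' k' J₁ J₂ K K' : ℕ) :
    (LinearMap.adjoint (coupling J₁ J₂ K) ∘ₗ recouplingAdj j₁ j₂ k j₁' j₂' k' J₁ J₂) ∘ₗ
      (recoupling j₁ j₂ k j₁' j₂' k' J₁ J₂ ∘ₗ coupling J₁ J₂ K') =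
      if h : K' = K then structConst j₁ j₂ k j₁' j₂' k' J₁ J₂ K •
        (h ▸ (LinearMap.id : SpinSpace K' →ₗ[ℂ] SpinSpace K') : SpinSpace K' →ₗ[ℂ] SpinSpace K)
      else 0 := by
  have h1 : LinearMap.adjoint (coupling J₁ J₂ K) ∘ₗ recouplingAdj j₁ j₂ k j₁' j₂' k' J₁ J₂ =
      ((√(k + 1 : ℝ) * √(k' + 1 : ℝ) * √(J₁ + 1 : ℝ) * √(J₂ + 1 : ℝ) *
        nineJ j₁ j₂ k j₁' j₂' k' J₁ J₂ K : ℝ) : ℂ) • LinearMap.adjoint (coupling k k' K) := by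
    have h := (isAdjointPair_recoupling j₁ j₂ k j₁' j₂' k' J₁ J₂).comp
      (isAdjointPair_adjoint (coupling J₁ J₂ K))
    rw [recoupling_comp_coupling, IsAdjointPair, map_smulₛₗ, Complex.conj_ofReal] at h
    exact h
  rw [h1, recoupling_comp_coupling, LinearMap.smul_comp, LinearMap.comp_smul, smul_smul]
  split_ifs with h
  · subst h
    by_cases hT : Triangle k k' K'
    · rw [adjoint_coupling_comp_self hT, structConst, ← Complex.ofReal_mul]
      congr 2
      have e : ∀ n : ℕ, √(n + 1 : ℝ) ^ 2 = n + 1 := fun n => Real.sq_sqrt (by positivity)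
      calc _ = √(k + 1 : ℝ) ^ 2 * √(k' + 1 : ℝ) ^ 2 * √(J₁ + 1 : ℝ) ^ 2 * √(J₂ + 1 : ℝ) ^ 2 *
            nineJ j₁ j₂ k j₁' j₂' k' J₁ J₂ K' ^ 2 := by ring
        _ = _ := by rw [e, e, e, e]; ring
    -- Outside the triangle range `coupling k k' K'` is not an isometry, but the `9j` symbol is zero
    -- and both sides vanish.
    · rw [structConst, nineJ_eq_zero _ _ _ _ _ _ _ _ _ hT]
      simp
  · rw [adjoint_coupling_comp_of_ne k k' h, smul_zero]

/-- Resolving the identity on both sides by total spin leaves only diagonal terms, each a multiple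
of `P^K`. -/
theorem recouplingAdj_comp_recoupling (j₁ j₂ k j₁' j₂' k' J₁ J₂ : ℕ) :
    recouplingAdj j₁ j₂ k j₁' j₂' k' J₁ J₂ ∘ₗ recoupling j₁ j₂ k j₁' j₂' k' J₁ J₂ =
      ∑ K ∈ coupled J₁ J₂, structConst j₁ j₂ k j₁' j₂' k' J₁ J₂ K • twoSpinProj J₁ J₂ K := by
  have hsum := sum_coupling_comp_adjoint J₁ J₂
  calc _ = (∑ K ∈ coupled J₁ J₂, coupling J₁ J₂ K ∘ₗ LinearMap.adjoint (coupling J₁ J₂ K)) ∘ₗ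
        (recouplingAdj j₁ j₂ k j₁' j₂' k' J₁ J₂ ∘ₗ recoupling j₁ j₂ k j₁' j₂' k' J₁ J₂) ∘ₗ
        (∑ K ∈ coupled J₁ J₂, coupling J₁ J₂ K ∘ₗ LinearMap.adjoint (coupling J₁ J₂ K)) := by
        rw [hsum, LinearMap.id_comp, LinearMap.comp_id]
    _ = ∑ K ∈ coupled J₁ J₂, ∑ K' ∈ coupled J₁ J₂, coupling J₁ J₂ K ∘ₗ
        ((LinearMap.adjoint (coupling J₁ J₂ K) ∘ₗ recouplingAdj j₁ j₂ k j₁' j₂' k' J₁ J₂) ∘ₗ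
          (recoupling j₁ j₂ k j₁' j₂' k' J₁ J₂ ∘ₗ coupling J₁ J₂ K')) ∘ₗ
        LinearMap.adjoint (coupling J₁ J₂ K') := by
        rw [linearMap_sum_comp]
        refine Finset.sum_congr rfl fun K _ => ?_
        rw [linearMap_comp_sum, linearMap_comp_sum]
        simp only [LinearMap.comp_assoc]
    _ = _ := by
        refine Finset.sum_congr rfl fun K hK => ?_
        rw [Finset.sum_eq_single K]
        · rw [adjoint_coupling_comp_recoupling, dif_pos rfl, LinearMap.smul_comp,
            LinearMap.comp_smul, LinearMap.id_comp, twoSpinProj_eq hK]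
        · intro K' _ hne
          rw [adjoint_coupling_comp_recoupling, dif_neg hne, LinearMap.zero_comp,
            LinearMap.comp_zero]
        · exact fun h => absurd hK h

/-! ### The product formula -/

theorem map_twoSpinProj {j₁ j₂ k j₁' j₂' k' : ℕ} (hk : k ∈ coupled j₁ j₂)
    (hk' : k' ∈ coupled j₁' j₂') :
    TensorProduct.map (twoSpinProj j₁ j₂ k) (twoSpinProj j₁' j₂' k') =
      TensorProduct.map (coupling j₁ j₂ k) (coupling j₁' j₂' k') ∘ₗ
        TensorProduct.map (LinearMap.adjoint (coupling j₁ j₂ k))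
          (LinearMap.adjoint (coupling j₁' j₂' k')) := by
  rw [twoSpinProj_eq hk, twoSpinProj_eq hk', TensorProduct.map_comp]

theorem blockDiagPart_map_twoSpinProj {j₁ j₂ k j₁' j₂' k' : ℕ} (hk : k ∈ coupled j₁ j₂)
    (hk' : k' ∈ coupled j₁' j₂') :
    blockDiagPart j₁ j₂ j₁' j₂'
        (TensorProduct.map (twoSpinProj j₁ j₂ k) (twoSpinProj j₁' j₂' k')) =
      ∑ J₁ ∈ coupled j₁ j₁', ∑ J₂ ∈ coupled j₂ j₂', ∑ K ∈ coupled J₁ J₂,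
        structConst j₁ j₂ k j₁' j₂' k' J₁ J₂ K • grandProj j₁ j₂ j₁' j₂' J₁ J₂ K := by
  rw [blockDiagPart, map_twoSpinProj hk hk']
  refine Finset.sum_congr rfl fun J₁ h₁ => Finset.sum_congr rfl fun J₂ h₂ => ?_
  rw [copyProj_eq h₁ h₂]
  -- Since `P^k ⊗ P^{k'}` factors through `H_k ⊗ H_{k'}`, its compression to a copy is `R† R`.
  calc _ = embed j₁ j₂ j₁' j₂' J₁ J₂ ∘ₗ (recouplingAdj j₁ j₂ k j₁' j₂' k' J₁ J₂ ∘ₗ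
        recoupling j₁ j₂ k j₁' j₂' k' J₁ J₂) ∘ₗ embedAdj j₁ j₂ j₁' j₂' J₁ J₂ := by
        simp only [recouplingAdj, recoupling, LinearMap.comp_assoc]
    _ = _ := by
        rw [recouplingAdj_comp_recoupling, linearMap_sum_comp, linearMap_comp_sum]
        refine Finset.sum_congr rfl fun K hK => ?_
        rw [grandProj_eq h₁ h₂ hK, LinearMap.smul_comp, LinearMap.comp_smul]

/-- Each copy is invariant under the group. By cyclicity both traces equal the sum over copies of
`Tr (E† A E D_{J₁J₂}(g))`, where `D_{J₁J₂}` is `pairRep J₁ J₂`. -/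
theorem trace_eq_trace_blockDiagPart (a b a' b' : ℕ)
    (A : FourSpace a b a' b' →ₗ[ℂ] FourSpace a b a' b') (g : SU2 × SU2) :
    LinearMap.trace ℂ _ (A ∘ₗ fourRep a b a' b' g) =
      LinearMap.trace ℂ _ (blockDiagPart a b a' b' A ∘ₗ fourRep a b a' b' g) := by
  have h : A ∘ₗ fourRep a b a' b' g = ∑ J₁ ∈ coupled a a', ∑ J₂ ∈ coupled b b',
      embed a b a' b' J₁ J₂ ∘ₗ (embedAdj a b a' b' J₁ J₂ ∘ₗ A ∘ₗ fourRep a b a' b' g) := by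
    simp_rw [← LinearMap.comp_assoc, ← linearMap_sum_comp]
    rw [sum_embed_comp_embedAdj, LinearMap.id_comp]
  rw [h, blockDiagPart, linearMap_sum_comp, map_sum, map_sum]
  refine Finset.sum_congr rfl fun J₁ h₁ => ?_
  rw [linearMap_sum_comp, map_sum, map_sum]
  refine Finset.sum_congr rfl fun J₂ h₂ => ?_
  rw [copyProj_eq h₁ h₂, LinearMap.trace_comp_comm']
  symm
  simp only [LinearMap.comp_assoc]
  rw [embedAdj_comp_fourRep, LinearMap.trace_comp_comm']
  simp only [LinearMap.comp_assoc]
  rw [embedAdj_comp_self h₁ h₂, LinearMap.comp_id, fourRep_comp_embed]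

/-- Cyclicity moves the isometry `E` around the trace, and its equivariance with `E† E = 1` leaves
the trace on `H_{J₁} ⊗ H_{J₂}`. -/
theorem trace_grandProj {a b a' b' J₁ J₂ K : ℕ} (h₁ : J₁ ∈ coupled a a') (h₂ : J₂ ∈ coupled b b')
    (hK : K ∈ coupled J₁ J₂) (u v : SU2) :
    LinearMap.trace ℂ _ (grandProj a b a' b' J₁ J₂ K ∘ₗ fourRep a b a' b' (u, v)) =
      quasichar J₁ J₂ K u v := by
  rw [grandProj_eq h₁ h₂ hK, LinearMap.comp_assoc, LinearMap.trace_comp_comm']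
  simp only [LinearMap.comp_assoc]
  rw [fourRep_comp_embed, ← LinearMap.comp_assoc _ _ (embedAdj a b a' b' J₁ J₂),
    embedAdj_comp_self h₁ h₂, LinearMap.id_comp, quasichar]

theorem trace_map_twoSpinProj {j₁ j₂ k j₁' j₂' k' : ℕ} (hk : k ∈ coupled j₁ j₂)
    (hk' : k' ∈ coupled j₁' j₂') (u v : SU2) :
    LinearMap.trace ℂ _
        (TensorProduct.map (twoSpinProj j₁ j₂ k) (twoSpinProj j₁' j₂' k') ∘ₗ
          fourRep j₁ j₂ j₁' j₂' (u, v)) =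
      ∑ J₁ ∈ coupled j₁ j₁', ∑ J₂ ∈ coupled j₂ j₂', ∑ K ∈ coupled J₁ J₂,
        structConst j₁ j₂ k j₁' j₂' k' J₁ J₂ K *
          LinearMap.trace ℂ _
            (grandProj j₁ j₂ j₁' j₂' J₁ J₂ K ∘ₗ fourRep j₁ j₂ j₁' j₂' (u, v)) := by
  rw [trace_eq_trace_blockDiagPart, blockDiagPart_map_twoSpinProj hk hk', linearMap_sum_comp,
    map_sum]
  refine Finset.sum_congr rfl fun J₁ _ => ?_
  rw [linearMap_sum_comp, map_sum]
  refine Finset.sum_congr rfl fun J₂ _ => ?_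
  rw [linearMap_sum_comp, map_sum]
  refine Finset.sum_congr rfl fun K _ => ?_
  rw [LinearMap.smul_comp, map_smul, smul_eq_mul]

theorem quasichar_mul_quasichar_eq_trace (j₁ j₂ k j₁' j₂' k' : ℕ) (u v : SU2) :
    quasichar j₁ j₂ k u v * quasichar j₁' j₂' k' u v =
      LinearMap.trace ℂ _
        (TensorProduct.map (twoSpinProj j₁ j₂ k) (twoSpinProj j₁' j₂' k') ∘ₗ
          fourRep j₁ j₂ j₁' j₂' (u, v)) := by
  rw [fourRep_apply, ← TensorProduct.map_comp, LinearMap.trace_tensorProduct', quasichar, quasichar]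

end SpinRecoupling

end

open SpinRecoupling in
theorem mainTheorem1 (j₁ j₂ k j₁' j₂' k' : ℕ)
    (hk : k ∈ coupled j₁ j₂) (hk' : k' ∈ coupled j₁' j₂') :
    blockDiagPart j₁ j₂ j₁' j₂'
        (TensorProduct.map (twoSpinProj j₁ j₂ k) (twoSpinProj j₁' j₂' k')) =
      ∑ J₁ ∈ coupled j₁ j₁', ∑ J₂ ∈ coupled j₂ j₂', ∑ K ∈ coupled J₁ J₂,
        structConst j₁ j₂ k j₁' j₂' k' J₁ J₂ K • grandProj j₁ j₂ j₁' j₂' J₁ J₂ K ∧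
    (∀ u v : SU2,
      LinearMap.trace ℂ _
          (TensorProduct.map (twoSpinProj j₁ j₂ k) (twoSpinProj j₁' j₂' k') ∘ₗ
            fourRep j₁ j₂ j₁' j₂' (u, v)) =
        ∑ J₁ ∈ coupled j₁ j₁', ∑ J₂ ∈ coupled j₂ j₂', ∑ K ∈ coupled J₁ J₂,
          structConst j₁ j₂ k j₁' j₂' k' J₁ J₂ K *
            LinearMap.trace ℂ _
              (grandProj j₁ j₂ j₁' j₂' J₁ J₂ K ∘ₗ fourRep j₁ j₂ j₁' j₂' (u, v))) ∧
    (∀ u v : SU2,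
      quasichar j₁ j₂ k u v * quasichar j₁' j₂' k' u v =
        ∑ J₁ ∈ coupled j₁ j₁', ∑ J₂ ∈ coupled j₂ j₂', ∑ K ∈ coupled J₁ J₂,
          structConst j₁ j₂ k j₁' j₂' k' J₁ J₂ K * quasichar J₁ J₂ K u v) := by
  refine ⟨blockDiagPart_map_twoSpinProj hk hk', trace_map_twoSpinProj hk hk', fun u v => ?_⟩
  rw [quasichar_mul_quasichar_eq_trace, trace_map_twoSpinProj hk hk']
  refine Finset.sum_congr rfl fun J₁ h₁ => Finset.sum_congr rfl fun J₂ h₂ =>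
    Finset.sum_congr rfl fun K hK => ?_
  rw [trace_grandProj h₁ h₂ hK]
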